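/- Let $\mathfrak{Comm}$ denote either the category of commutative unital $\mathbb C$-algebras with unital algebra homomorphisms, or the category of commutative, not necessarily unital $\mathbb C$-algebras with all algebra homomorphisms. Let $\mathfrak{Ab}$ be the category of abelian groups, let $\mathfrak{Comp}$ be the category of compact Hausdorff spaces and continuous maps, and let $\mathfrak{Pol}\subset\mathfrak{Comp}$ be the full subcategory of compact polyhedra, i.e. of the spaces homeomorphic to the underlying space of a finite simplicial complex in some $\mathbb R^n$. For $X\in\mathfrak{Comp}$ write $C(X)$ for the $\mathbb C$-algebra of continuous functions $X\to\mathbb C$; a continuous map $X\to Y$ induces $C(Y)\to C(X)$ by precomposition. A contravariant functor on $\mathfrak{Comp}$ or on $\mathfrak{Pol}$ is called homotopy invariant if any two homotopic continuous maps between objects of the category induce the same homomorphism. Let $E:\mathfrak{Comm}\to\mathfrak{Ab}$ be a functor such that 1. $E$ commutes with filtered colimits; 2. the contravariant functor $\mathfrak{Pol}\to\mathfrak{Ab}$, $D\mapsto E(C(D))$, is homotopy invariant. Then the contravariant functor $\mathfrak{Comp}\to\mathfrak{Ab}$, $X\mapsto E(C(X))$, is homotopy invariant. -/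

import Mathlib

open CategoryTheory CategoryTheory.Limits Opposite

universe u

/-- A compact polyhedron: a topological space homeomorphic to the underlying space of a finite
geometric simplicial complex in some Euclidean space `ℝⁿ`. -/
def IsCompactPolyhedron (X : TopCat.{u}) : Prop :=
  ∃ (n : ℕ) (K : Geometry.SimplicialComplex ℝ (EuclideanSpace ℝ (Fin n))),
    K.faces.Finite ∧ Nonempty (X ≃ₜ K.space)

/-- `CompHausLike P` is the full subcategory (all continuous maps) of compact Hausdorff spaces with
the property `P`: it is the category of compact polyhedra for `P = IsCompactPolyhedron` and that of
all compact Hausdorff spaces for `P = fun _ => True`. A contravariant functor on it is homotopy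
invariant if homotopic maps induce the same morphism. -/
def IsHomotopyInvariant {P : TopCat.{u} → Prop} {A : Type*} [Category A]
    (G : (CompHausLike.{u} P)ᵒᵖ ⥤ A) : Prop :=
  ∀ ⦃X Y : CompHausLike.{u} P⦄ (f g : X ⟶ Y),
    ContinuousMap.Homotopic (X := X) (Y := Y)
        (ConcreteCategory.hom (C := CompHausLike.{u} P) f)
        (ConcreteCategory.hom (C := CompHausLike.{u} P) g) →
      G.map f.op = G.map g.op

/-- The contravariant functor `X ↦ C(X)`, the unital commutative `ℂ`-algebra of continuous
complex valued functions on `X`; a continuous map acts by precomposition. -/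
noncomputable def continuousFunctions (P : TopCat.{u} → Prop) :
    (CompHausLike.{u} P)ᵒᵖ ⥤ CommAlgCat.{u} ℂ where
  obj X := CommAlgCat.of ℂ C(X.unop, ℂ)
  map f := CommAlgCat.ofHom
    (ContinuousMap.compRightAlgHom ℂ ℂ (ConcreteCategory.hom f.unop))
  map_id _ := rfl
  map_comp _ _ := rfl

/-- Commutative associative, not necessarily unital, `ℂ`-algebras. -/
structure NonUnitalCommAlgCat where
  /-- The underlying type. -/
  carrier : Type u
  [ring : NonUnitalCommRing carrier]
  [module : Module ℂ carrier]
  [isScalarTower : IsScalarTower ℂ carrier carrier]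
  [smulCommClass : SMulCommClass ℂ carrier carrier]

attribute [instance] NonUnitalCommAlgCat.ring NonUnitalCommAlgCat.module
  NonUnitalCommAlgCat.isScalarTower NonUnitalCommAlgCat.smulCommClass

/-- Morphisms are the `ℂ`-linear multiplicative maps. -/
instance : Category NonUnitalCommAlgCat.{u} where
  Hom A B := A.carrier →ₙₐ[ℂ] B.carrier
  id A := NonUnitalAlgHom.id ℂ A.carrier
  comp f g := NonUnitalAlgHom.comp g f

/-- The functor that forgets that an algebra and its homomorphisms are unital. -/
def forgetUnit : CommAlgCat.{u} ℂ ⥤ NonUnitalCommAlgCat.{u} where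
  obj A := { carrier := A }
  map f := NonUnitalAlgHomClass.toNonUnitalAlgHom (CommAlgCat.Hom.hom f)
  map_id _ := rfl
  map_comp _ _ := rfl

/-! An algebra is the filtered colimit of its finitely generated unital subalgebras, also after
units are forgotten, so each class over C(Y) comes from some A = ℂ[x]/I inside C(Y)
(`IsFinitelySupported`). The generators give a map e from Y to K, the part of the variety of I in a
large ball. Every map w : T → K induces A → C(T), hence a class Ψ(w), naturally in T; for w = e ∘ v
it is the pullback along v of the given class. It remains to see that Ψ is homotopy invariant on
maps X → K.

Suppose K is a retract of an open set U. If two maps X → K are close, the segments between them stay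
in U. The pair of maps factors through a polyhedron P, and the segment homotopy on I × P factors
through a polyhedron Q mapping to U (`exists_polyhedron_factorization`). Retracting to K gives one
class on Q whose pullbacks along homotopic maps P → Q yield both classes on X, so the hypothesis on
polyhedra applies (`class_eq_of_close`). Hence Ψ is locally constant along a homotopy, and therefore
constant.

The retraction is obtained without triangulating semialgebraic sets. `IsPolyIntegral.isANE_zeros`
treats compact zero sets of continuous functions integral over the polynomials, by induction on the
dimension. After a linear change of coordinates, finitely many continuous integral graphs
(`exists_root_functions`) cut each vertical line into intervals inside which h vanishes identically
or nowhere. So the zero set is a finite union of bands over zero sets in one dimension less. Bands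
inherit the extension property by Tietze, and their unions by gluing. Integral functions make the
induction close: they contain these root functions and are stable under maxima and substitution. -/

open Set Topology

/-! ### Absolute neighbourhood extensors and gluing -/

/-- A set `S` is an absolute neighbourhood extensor (for metric spaces) if every continuous map
from a closed subset of a metric space to `S` extends continuously to a neighbourhood. -/
def IsANE {E : Type} [TopologicalSpace E] (S : Set E) : Prop :=
  ∀ (X : Type) [MetricSpace X] (A : Set X) (f : X → E), IsClosed A → ContinuousOn f A →
    MapsTo f A S → ∃ (U : Set X) (g : X → E), IsOpen U ∧ A ⊆ U ∧ ContinuousOn g U ∧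
      MapsTo g U S ∧ EqOn g f A

theorem IsANE.empty {E : Type} [TopologicalSpace E] : IsANE (∅ : Set E) := by
  intro X _ A f _ _ hm
  have hA : A = ∅ := by
    ext x
    exact ⟨fun hx => (hm hx).elim, fun hx => hx.elim⟩
  subst hA
  exact ⟨∅, f, isOpen_empty, le_rfl, by simp, by simp, by simp⟩

theorem IsANE.singleton {E : Type} [TopologicalSpace E] (e : E) : IsANE ({e} : Set E) := by
  intro X _ A f _ _ hm
  exact ⟨univ, fun _ => e, isOpen_univ, subset_univ _, continuousOn_const, fun _ _ => rfl,
    fun x hx => (hm hx).symm⟩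

theorem IsANE.image_homeomorph {E F : Type} [TopologicalSpace E] [TopologicalSpace F] {S : Set E}
    (hS : IsANE S) (e : E ≃ₜ F) : IsANE (e '' S) := by
  intro X _ A f hA hf hm
  obtain ⟨U, g, hU, hAU, hg, hgm, hgf⟩ := hS X A (e.symm ∘ f) hA
    (e.symm.continuous.comp_continuousOn hf) (fun x hx => by
      obtain ⟨s, hs, hsx⟩ := hm hx
      simpa [← hsx] using hs)
  exact ⟨U, e ∘ g, hU, hAU, e.continuous.comp_continuousOn hg, fun x hx => ⟨g x, hgm hx, rfl⟩,
    fun x hx => by simp [hgf hx]⟩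

/-- Split X into closed halves X1 and X2 that meet A only in the parts mapped to S and to T. First
extend into S ∩ T near A1 ∩ A2, restrict this to the interface of the halves, and then extend on
each side relative to it; the two extensions agree on the interface and can be pasted. -/
theorem IsANE.union {E : Type} [TopologicalSpace E] {S T : Set E} (hS : IsANE S) (hT : IsANE T)
    (hST : IsANE (S ∩ T)) (hSc : IsClosed S) (hTc : IsClosed T) : IsANE (S ∪ T) := by
  classical
  intro X _ A f hA hf hm
  have hA1c : IsClosed (A ∩ f ⁻¹' S) := hf.preimage_isClosed_of_isClosed hA hSc
  have hA2c : IsClosed (A ∩ f ⁻¹' T) := hf.preimage_isClosed_of_isClosed hA hTc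
  set A1 := A ∩ f ⁻¹' S with hA1
  set A2 := A ∩ f ⁻¹' T with hA2
  -- extend the pair of sets to a closed cover of the whole space
  obtain ⟨X1, X2, hX1, hX2, hX, hXA1, hXA2⟩ : ∃ X1 X2 : Set X, IsClosed X1 ∧ IsClosed X2 ∧
      X1 ∪ X2 = univ ∧ A ∩ X1 ⊆ A1 ∧ A ∩ X2 ⊆ A2 := by
    -- `Metric.infDist` to the empty set is 0, so comparing distances to A1 and A2 needs both to be
    -- nonempty.
    rcases A1.eq_empty_or_nonempty with h1 | h1
    · refine ⟨∅, univ, isClosed_empty, isClosed_univ, by simp, by simp, fun x hx => ⟨hx.1, ?_⟩⟩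
      rcases hm hx.1 with h | h
      · exact absurd (show x ∈ A1 from ⟨hx.1, h⟩) (by simp [h1])
      · exact h
    rcases A2.eq_empty_or_nonempty with h2 | h2
    · refine ⟨univ, ∅, isClosed_univ, isClosed_empty, by simp, fun x hx => ⟨hx.1, ?_⟩, by simp⟩
      rcases hm hx.1 with h | h
      · exact h
      · exact absurd (show x ∈ A2 from ⟨hx.1, h⟩) (by simp [h2])
    refine ⟨{x | Metric.infDist x A1 ≤ Metric.infDist x A2},
      {x | Metric.infDist x A2 ≤ Metric.infDist x A1},
      isClosed_le (Metric.continuous_infDist_pt _) (Metric.continuous_infDist_pt _),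
      isClosed_le (Metric.continuous_infDist_pt _) (Metric.continuous_infDist_pt _), ?_, ?_, ?_⟩
    · ext x
      simpa using le_total _ _
    · rintro x ⟨hx, hle⟩
      rcases hm hx with h | h
      · exact ⟨hx, h⟩
      · have h0 : Metric.infDist x A2 = 0 := Metric.infDist_zero_of_mem ⟨hx, h⟩
        have : Metric.infDist x A1 = 0 := le_antisymm (h0 ▸ hle) Metric.infDist_nonneg
        exact (hA1c.mem_iff_infDist_zero h1).2 this
    · rintro x ⟨hx, hle⟩
      rcases hm hx with h | h
      · have h0 : Metric.infDist x A1 = 0 := Metric.infDist_zero_of_mem ⟨hx, h⟩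
        have : Metric.infDist x A2 = 0 := le_antisymm (h0 ▸ hle) Metric.infDist_nonneg
        exact (hA2c.mem_iff_infDist_zero h2).2 this
      · exact ⟨hx, h⟩
  -- extend over a neighbourhood of the intersection
  obtain ⟨U0, g0, hU0, hAU0, hg0, hgm0, hgf0⟩ := hST X (A1 ∩ A2) f (hA1c.inter hA2c)
    (hf.mono fun x hx => hx.1.1) (fun x hx => ⟨hx.1.2, hx.2.2⟩)
  obtain ⟨O0, hO0, hAO0, hOU0⟩ := normal_exists_closure_subset (hA1c.inter hA2c) hU0 hAU0
  set W := closure O0 ∩ (X1 ∩ X2) with hW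
  have hWc : IsClosed W := isClosed_closure.inter (hX1.inter hX2)
  have hWU : W ⊆ U0 := fun x hx => hOU0 hx.1
  have hWA : ∀ x ∈ W, x ∈ A → x ∈ A1 ∩ A2 := fun x hx hxA =>
    ⟨hXA1 ⟨hxA, hx.2.1⟩, hXA2 ⟨hxA, hx.2.2⟩⟩
  -- extend over neighbourhoods of the two parts, compatibly on `W`
  have key : ∀ (R : Set E) (B : Set X), IsANE R → IsClosed B → B ⊆ A → MapsTo f B R →
      S ∩ T ⊆ R → ∃ (U : Set X) (g : X → E), IsOpen U ∧ B ∪ W ⊆ U ∧ ContinuousOn g U ∧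
      MapsTo g U R ∧ EqOn g f B ∧ EqOn g g0 W := by
    intro R B hR hB hBA hfB hSTR
    have hfg : ∀ x ∈ B, x ∈ W → g0 x = f x := fun x hx hxW => hgf0 (hWA x hxW (hBA hx))
    set F : X → E := fun x => if x ∈ W then g0 x else f x with hF
    have hFB : EqOn F f B := fun x hx => by
      by_cases h : x ∈ W
      · simp [hF, h, hfg x hx h]
      · simp [hF, h]
    have hFW : EqOn F g0 W := fun x hx => by simp [hF, hx]
    obtain ⟨U, g, hU, hBU, hg, hgm, hgf⟩ := hR X (B ∪ W) F (hB.union hWc)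
      (((hf.mono hBA).congr hFB).union_of_isClosed ((hg0.mono hWU).congr hFW) hB hWc)
      (by
        rintro x (hx | hx)
        · rw [hFB hx]; exact hfB hx
        · rw [hFW hx]; exact hSTR (hgm0 (hWU hx)))
    exact ⟨U, g, hU, hBU, hg, hgm, fun x hx => (hgf (Or.inl hx)).trans (hFB hx),
      fun x hx => (hgf (Or.inr hx)).trans (hFW hx)⟩
  obtain ⟨U1, g1, hU1, hAU1, hg1, hgm1, hgf1, hgW1⟩ := key S A1 hS hA1c inter_subset_left
    (fun x hx => hx.2) inter_subset_left
  obtain ⟨U2, g2, hU2, hAU2, hg2, hgm2, hgf2, hgW2⟩ := key T A2 hT hA2c inter_subset_left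
    (fun x hx => hx.2) inter_subset_right
  -- Inside V the interface lies in W, where g1 = g0 = g2, and each half lies in the domain of its
  -- own extension.
  set V := ((X1 ∩ X2) ∩ O0ᶜ)ᶜ ∩ ((X1ᶜ ∪ U1) ∩ (X2ᶜ ∪ U2)) with hV
  have hVo : IsOpen V := by
    refine IsOpen.inter ?_ (IsOpen.inter ?_ ?_)
    · exact ((hX1.inter hX2).inter hO0.isClosed_compl).isOpen_compl
    · exact hX1.isOpen_compl.union hU1
    · exact hX2.isOpen_compl.union hU2
  have hVW : ∀ x ∈ V, x ∈ X1 → x ∈ X2 → x ∈ W := fun x hx h1 h2 =>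
    ⟨subset_closure (by_contra fun h => hx.1 ⟨⟨h1, h2⟩, h⟩), h1, h2⟩
  have hV1 : ∀ x ∈ V, x ∈ X1 → x ∈ U1 := fun x hx h1 => hx.2.1.resolve_left (fun h => h h1)
  have hV2 : ∀ x ∈ V, x ∈ X2 → x ∈ U2 := fun x hx h1 => hx.2.2.resolve_left (fun h => h h1)
  set G : X → E := fun x => if x ∈ X1 then g1 x else g2 x with hG
  have hG1 : ∀ x ∈ X1, G x = g1 x := fun x hx => by simp [hG, hx]
  have hG2 : ∀ x ∈ V, x ∈ X2 → G x = g2 x := fun x hx h2 => by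
    by_cases h1 : x ∈ X1
    · rw [hG1 x h1, hgW1 (hVW x hx h1 h2), hgW2 (hVW x hx h1 h2)]
    · simp [hG, h1]
  refine ⟨V, G, hVo, ?_, ?_, ?_, ?_⟩
  · intro x hx
    refine ⟨fun h => h.2 (hAO0 ⟨hXA1 ⟨hx, h.1.1⟩, hXA2 ⟨hx, h.1.2⟩⟩), ?_, ?_⟩
    · by_cases h : x ∈ X1
      · exact Or.inr (hAU1 (Or.inl (hXA1 ⟨hx, h⟩)))
      · exact Or.inl h
    · by_cases h : x ∈ X2
      · exact Or.inr (hAU2 (Or.inl (hXA2 ⟨hx, h⟩)))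
      · exact Or.inl h
  · have h1 : ContinuousOn G (V ∩ X1) :=
      (hg1.mono fun x hx => hV1 x hx.1 hx.2).congr fun x hx => hG1 x hx.2
    have h2 : ContinuousOn G (V ∩ X2) :=
      (hg2.mono fun x hx => hV2 x hx.1 hx.2).congr fun x hx => hG2 x hx.1 hx.2
    intro x hx
    have e : V = (V ∩ X1) ∪ (V ∩ X2) := by rw [← inter_union_distrib_left, hX, inter_univ]
    have aux : ∀ Y : Set X, IsClosed Y → ContinuousOn G (V ∩ Y) →
        ContinuousWithinAt G (V ∩ Y) x := by
      intro Y hY hc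
      by_cases hxY : x ∈ Y
      · exact hc x ⟨hx, hxY⟩
      · refine continuousWithinAt_of_notMem_closure fun h => hxY ?_
        exact closure_minimal inter_subset_right hY h
    rw [e]
    exact (aux X1 hX1 h1).union (aux X2 hX2 h2)
  · intro x hx
    have : x ∈ X1 ∪ X2 := hX ▸ mem_univ x
    rcases this with h | h
    · rw [hG1 x h]; exact Or.inl (hgm1 (hV1 x hx h))
    · rw [hG2 x hx h]; exact Or.inr (hgm2 (hV2 x hx h))
  · intro x hx
    have : x ∈ X1 ∪ X2 := hX ▸ mem_univ x
    rcases this with h | h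
    · rw [hG1 x h]; exact hgf1 (hXA1 ⟨hx, h⟩)
    · rw [hG2 x (show x ∈ V from ?_) h]
      · exact hgf2 (hXA2 ⟨hx, h⟩)
      · refine ⟨fun h => h.2 (hAO0 ⟨hXA1 ⟨hx, h.1.1⟩, hXA2 ⟨hx, h.1.2⟩⟩), ?_, ?_⟩
        · by_cases h : x ∈ X1
          · exact Or.inr (hAU1 (Or.inl (hXA1 ⟨hx, h⟩)))
          · exact Or.inl h
        · exact Or.inr (hAU2 (Or.inl (hXA2 ⟨hx, h⟩)))

/-! ### Bands between two graphs, and finite unions -/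

/-- The points `(t, x)` with `x ∈ Z` and `a x ≤ t ≤ b x`. -/
def band {n : ℕ} (Z : Set (Fin n → ℝ)) (a b : (Fin n → ℝ) → ℝ) : Set (Fin (n + 1) → ℝ) :=
  {y | Fin.tail y ∈ Z ∧ a (Fin.tail y) ≤ y 0 ∧ y 0 ≤ b (Fin.tail y)}

theorem continuous_tail {n : ℕ} : Continuous (Fin.tail : (Fin (n + 1) → ℝ) → (Fin n → ℝ)) :=
  continuous_pi fun i => continuous_apply i.succ

theorem isClosed_band {n : ℕ} {Z : Set (Fin n → ℝ)} {a b : (Fin n → ℝ) → ℝ} (hZ : IsClosed Z)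
    (ha : Continuous a) (hb : Continuous b) : IsClosed (band Z a b) :=
  (hZ.preimage continuous_tail).inter
    ((isClosed_le (ha.comp continuous_tail) (continuous_apply 0)).inter
      (isClosed_le (continuous_apply 0) (hb.comp continuous_tail)))

/-- The base coordinates extend because Z is an extensor and the first coordinate extends by Tietze;
clamping the latter between a and b returns to the band. -/
theorem IsANE.band {n : ℕ} {Z : Set (Fin n → ℝ)} {a b : (Fin n → ℝ) → ℝ} (hZ : IsANE Z)
    (ha : Continuous a) (hb : Continuous b) (hab : ∀ x ∈ Z, a x ≤ b x) : IsANE (band Z a b) := by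
  intro X _ A f hA hf hm
  obtain ⟨U, g, hU, hAU, hg, hgm, hgf⟩ := hZ X A (fun x => Fin.tail (f x)) hA
    (continuous_tail.comp_continuousOn hf) (fun x hx => (hm hx).1)
  obtain ⟨τ, hτ⟩ := ContinuousMap.exists_restrict_eq hA
    ⟨A.domRestrict fun x => f x 0, ((continuous_apply 0).comp_continuousOn hf).domRestrict⟩
  have hτA : ∀ x ∈ A, τ x = f x 0 := fun x hx => DFunLike.congr_fun hτ ⟨x, hx⟩
  refine ⟨U, fun x => Fin.cons (max (a (g x)) (min (b (g x)) (τ x))) (g x), hU, hAU, ?_, ?_, ?_⟩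
  · refine continuousOn_pi.2 fun i => ?_
    refine Fin.cases ?_ (fun i => ?_) i
    · simp only [Fin.cons_zero]
      exact ContinuousOn.sup (f := fun x => a (g x)) (ha.comp_continuousOn hg)
        (ContinuousOn.inf (f := fun x => b (g x)) (hb.comp_continuousOn hg)
          τ.continuous.continuousOn)
    · simp only [Fin.cons_succ]
      exact (continuous_apply i).comp_continuousOn hg
  · intro x hx
    have := hab _ (hgm hx)
    refine ⟨by simpa using hgm hx, by simp, by simp [this]⟩
  · intro x hx
    have h := hm hx
    have h1 : g x = Fin.tail (f x) := hgf hx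
    simp only [h1, hτA x hx, min_eq_right h.2.2, max_eq_right h.2.1]
    exact Fin.cons_self_tail _

/-- A family of closed sets that is stable under intersections and consists of absolute
neighbourhood extensors has the same property for finite unions. -/
theorem IsANE.biUnion {E ι : Type} [TopologicalSpace E] (𝒞 : Set (Set E))
    (hcl : ∀ C ∈ 𝒞, IsClosed C) (hane : ∀ C ∈ 𝒞, IsANE C)
    (hinter : ∀ C ∈ 𝒞, ∀ D ∈ 𝒞, C ∩ D ∈ 𝒞) (s : Finset ι) (C : ι → Set E)
    (hC : ∀ i ∈ s, C i ∈ 𝒞) : IsANE (⋃ i ∈ s, C i) := by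
  classical
  induction s using Finset.induction_on generalizing C with
  | empty => simpa using IsANE.empty
  | insert i s _ ih =>
    rw [Finset.set_biUnion_insert]
    refine (hane _ (hC i (by simp))).union (ih C fun j hj => hC j (by simp [hj])) ?_
      (hcl _ (hC i (by simp)))
      (isClosed_biUnion_finset fun j hj => hcl _ (hC j (by simp [hj])))
    -- The intersection with the remaining union is a union of fewer members of 𝒞, which is why the
    -- induction runs over all C.
    rw [inter_iUnion₂]
    exact ih _ fun j hj => hinter _ (hC i (by simp)) _ (hC j (by simp [hj]))

/-! ### Continuous functions integral over the polynomials -/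

/-- The inclusion of the real polynomials in `n` variables in the ring of functions on `ℝⁿ`. -/
noncomputable def polyFun (n : ℕ) : MvPolynomial (Fin n) ℝ →+* ((Fin n → ℝ) → ℝ) :=
  RingHom.pi fun x => MvPolynomial.eval x

@[simp]
theorem polyFun_apply {n : ℕ} (p : MvPolynomial (Fin n) ℝ) (x : Fin n → ℝ) :
    polyFun n p x = MvPolynomial.eval x p := rfl

/-- The subring of functions on `ℝⁿ` that are integral over the polynomials. -/
noncomputable def integralFun (n : ℕ) : Subring ((Fin n → ℝ) → ℝ) :=
  let := (polyFun n).toAlgebra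
  (integralClosure (MvPolynomial (Fin n) ℝ) ((Fin n → ℝ) → ℝ)).toSubring

theorem polyFun_mem_integralFun {n : ℕ} (p : MvPolynomial (Fin n) ℝ) :
    polyFun n p ∈ integralFun n := (polyFun n).isIntegralElem_map

/-- Transitivity of integrality: monic equations may have integral functions as coefficients. -/
theorem mem_integralFun_of_isIntegralElem {n : ℕ} {f : (Fin n → ℝ) → ℝ}
    (hf : (integralFun n).subtype.IsIntegralElem f) : f ∈ integralFun n := by
  let := (polyFun n).toAlgebra
  have h : IsIntegral (integralClosure (MvPolynomial (Fin n) ℝ) ((Fin n → ℝ) → ℝ)) f := hf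
  exact isIntegral_trans (R := MvPolynomial (Fin n) ℝ) f h

/-- Continuous functions on `ℝⁿ` that are integral over the polynomials. -/
def IsPolyIntegral {n : ℕ} (f : (Fin n → ℝ) → ℝ) : Prop :=
  Continuous f ∧ f ∈ integralFun n

namespace IsPolyIntegral

variable {n : ℕ} {f g : (Fin n → ℝ) → ℝ}

theorem add (hf : IsPolyIntegral f) (hg : IsPolyIntegral g) :
    IsPolyIntegral (fun x => f x + g x) :=
  ⟨hf.1.add hg.1, (integralFun n).add_mem hf.2 hg.2⟩

theorem mul (hf : IsPolyIntegral f) (hg : IsPolyIntegral g) :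
    IsPolyIntegral (fun x => f x * g x) :=
  ⟨hf.1.mul hg.1, (integralFun n).mul_mem hf.2 hg.2⟩

theorem sub (hf : IsPolyIntegral f) (hg : IsPolyIntegral g) :
    IsPolyIntegral (fun x => f x - g x) :=
  ⟨hf.1.sub hg.1, (integralFun n).sub_mem hf.2 hg.2⟩

theorem poly (p : MvPolynomial (Fin n) ℝ) : IsPolyIntegral (fun x => MvPolynomial.eval x p) :=
  ⟨MvPolynomial.continuous_eval p, polyFun_mem_integralFun p⟩

theorem const (c : ℝ) : IsPolyIntegral (fun _ : Fin n → ℝ => c) := by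
  simpa using poly (n := n) (MvPolynomial.C c)

theorem coord (i : Fin n) : IsPolyIntegral (fun x : Fin n → ℝ => x i) := by
  simpa using poly (n := n) (MvPolynomial.X i)

theorem pow (hf : IsPolyIntegral f) (k : ℕ) : IsPolyIntegral (fun x => f x ^ k) :=
  ⟨hf.1.pow k, (integralFun n).pow_mem hf.2 k⟩

theorem sum {ι : Type*} (s : Finset ι) {f : ι → (Fin n → ℝ) → ℝ}
    (hf : ∀ i ∈ s, IsPolyIntegral (f i)) : IsPolyIntegral (fun x => ∑ i ∈ s, f i x) := by
  refine ⟨continuous_finsetSum s fun i hi => (hf i hi).1, ?_⟩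
  have : (fun x => ∑ i ∈ s, f i x) = ∑ i ∈ s, f i := by ext; simp
  rw [this]
  exact (integralFun n).sum_mem fun i hi => (hf i hi).2

/-- A continuous function is integral if pointwise it is a root of a fixed monic polynomial with
integral coefficients. -/
theorem of_monic (hf : Continuous f) (P : Polynomial (integralFun n)) (hP : P.Monic)
    (h : ∀ x, P.eval₂ ((Pi.evalRingHom (fun _ : Fin n → ℝ => ℝ) x).comp (integralFun n).subtype)
      (f x) = 0) : IsPolyIntegral f := by
  refine ⟨hf, mem_integralFun_of_isIntegralElem ⟨P, hP, ?_⟩⟩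
  ext x
  have := Polynomial.hom_eval₂ P (integralFun n).subtype
    (Pi.evalRingHom (fun _ : Fin n → ℝ => ℝ) x) f
  exact this.trans (h x)

/-- The maximum is pointwise a root of (T - f)(T - g). -/
theorem max (hf : IsPolyIntegral f) (hg : IsPolyIntegral g) :
    IsPolyIntegral (fun x => max (f x) (g x)) := by
  refine of_monic (hf.1.max hg.1)
    ((Polynomial.X - Polynomial.C ⟨f, hf.2⟩) * (Polynomial.X - Polynomial.C ⟨g, hg.2⟩))
    ((Polynomial.monic_X_sub_C _).mul (Polynomial.monic_X_sub_C _)) fun x => ?_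
  rcases max_choice (f x) (g x) with h | h <;> simp [h]

theorem comp {m : ℕ} {h : (Fin m → ℝ) → ℝ} (hh : IsPolyIntegral h) {s : Fin m → (Fin n → ℝ) → ℝ}
    (hs : ∀ i, IsPolyIntegral (s i)) : IsPolyIntegral (fun x => h fun i => s i x) := by
  refine ⟨hh.1.comp (continuous_pi fun i => (hs i).1), ?_⟩
  obtain ⟨P, hP, hP0⟩ := hh.2
  let φ : MvPolynomial (Fin m) ℝ →+* integralFun n :=
    MvPolynomial.eval₂Hom (((polyFun n).comp MvPolynomial.C).codRestrict (integralFun n)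
      fun c => polyFun_mem_integralFun _) fun i => ⟨s i, (hs i).2⟩
  let ψ : ((Fin m → ℝ) → ℝ) →+* ((Fin n → ℝ) → ℝ) :=
    RingHom.pi fun x => Pi.evalRingHom _ fun i => s i x
  have hφ : (integralFun n).subtype.comp φ = ψ.comp (polyFun m) := by
    refine MvPolynomial.ringHom_ext (fun r => ?_) (fun i => ?_)
    · ext x; simp [φ, ψ]
    · ext x; simp [φ, ψ]
  refine mem_integralFun_of_isIntegralElem ⟨P.map φ, hP.map φ, ?_⟩
  rw [Polynomial.eval₂_map, hφ]
  have := Polynomial.hom_eval₂ P (polyFun m) ψ h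
  change Polynomial.eval₂ (polyFun m) h P = 0 at hP0
  rw [hP0, map_zero] at this
  exact this.symm

end IsPolyIntegral

/-- An integral function has a continuous complementary factor: `h * k = 0`, and off the zeros of
a nonzero polynomial, `h` and `k` have no common zeros. -/
theorem IsPolyIntegral.exists_complement {n : ℕ} {h : (Fin n → ℝ) → ℝ} (hh : IsPolyIntegral h) :
    ∃ (q : MvPolynomial (Fin n) ℝ) (k : (Fin n → ℝ) → ℝ), q ≠ 0 ∧ Continuous k ∧
      (∀ x, h x = 0 ∨ k x = 0) ∧
      ∀ x, MvPolynomial.eval x q ≠ 0 → h x = 0 → k x ≠ 0 := by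
  obtain ⟨P, hP, hP0⟩ := hh.2
  -- Write P = T ^ r * Q with Q(0) ≠ 0, and take k = Q(h), q = Q(0). Then h ^ r * k = P(h) = 0, and
  -- k equals q wherever h vanishes.
  obtain ⟨Q, hQ, hQ0⟩ := Polynomial.exists_eq_pow_rootMultiplicity_mul_and_not_dvd P hP.ne_zero 0
  rw [map_zero, sub_zero] at hQ hQ0
  rw [Polynomial.X_dvd_iff] at hQ0
  refine ⟨Q.coeff 0, fun x => Q.eval₂ (MvPolynomial.eval x) (h x), hQ0, ?_, fun x => ?_,
    fun x hx hx0 => ?_⟩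
  · simp only [Polynomial.eval₂_eq_sum_range]
    exact continuous_finsetSum _ fun i _ => (MvPolynomial.continuous_eval _).mul (hh.1.pow i)
  · have h1 : P.eval₂ (MvPolynomial.eval x) (h x) = 0 := by
      have := Polynomial.hom_eval₂ P (polyFun n) (Pi.evalRingHom (fun _ : Fin n → ℝ => ℝ) x) h
      change Polynomial.eval₂ (polyFun n) h P = 0 at hP0
      rw [hP0, map_zero] at this
      exact this.symm
    rw [hQ, Polynomial.eval₂_mul, Polynomial.eval₂_pow, Polynomial.eval₂_X, mul_eq_zero] at h1
    exact h1.imp (fun h => eq_zero_of_pow_eq_zero h) id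
  · simpa [hx0, Polynomial.eval₂_at_zero] using hx

/-! ### Continuous root functions of monic polynomials -/

/-- The unique minimum point of a family of functions on varying intervals is continuous. -/
theorem continuous_of_unique_argmin {X : Type*} [TopologicalSpace X] {F : X → ℝ → ℝ}
    (hF : Continuous fun z : X × ℝ => F z.1 z.2) {a b ρ : X → ℝ} (ha : Continuous a)
    (hb : Continuous b) (hρ : ∀ x, ρ x ∈ Icc (a x) (b x))
    (hmin : ∀ x, ∀ s ∈ Icc (a x) (b x), F x (ρ x) ≤ F x s)
    (huniq : ∀ x, ∀ t ∈ Icc (a x) (b x), (∀ s ∈ Icc (a x) (b x), F x t ≤ F x s) → t = ρ x) :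
    Continuous ρ := by
  rw [continuous_iff_continuousAt]
  intro x₀
  -- The interval moves with x, so competitors are parametrized by a fixed l in [0, 1], which makes
  -- each condition closed. G is the graph of ρ, and a locally bounded real function with closed
  -- graph is continuous.
  set G : Set (X × ℝ) := {z | a z.1 ≤ z.2} ∩ {z | z.2 ≤ b z.1} ∩
    ⋂ l ∈ Icc (0 : ℝ) 1, {z | F z.1 z.2 ≤ F z.1 (a z.1 + l * (b z.1 - a z.1))} with hG
  have hGc : IsClosed G := by
    refine ((isClosed_le (ha.comp continuous_fst) continuous_snd).inter
      (isClosed_le continuous_snd (hb.comp continuous_fst))).inter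
      (isClosed_biInter fun l _ => isClosed_le hF ?_)
    exact hF.comp (continuous_fst.prodMk ((ha.comp continuous_fst).add
      (continuous_const.mul ((hb.comp continuous_fst).sub (ha.comp continuous_fst)))))
  have hρG : ∀ x, (x, ρ x) ∈ G := by
    intro x
    have hab : a x ≤ b x := (hρ x).1.trans (hρ x).2
    refine ⟨⟨(hρ x).1, (hρ x).2⟩, mem_iInter₂.2 fun l hl => hmin x _ ⟨?_, ?_⟩⟩
    · nlinarith [mul_nonneg hl.1 (sub_nonneg.2 hab)]
    · nlinarith [mul_nonneg (sub_nonneg.2 hl.2) (sub_nonneg.2 hab)]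
  have hGρ : ∀ x t, (x, t) ∈ G → t = ρ x := by
    rintro x t ⟨⟨h1, h2⟩, h3⟩
    refine huniq x t ⟨h1, h2⟩ fun s hs => ?_
    rcases hs.1.eq_or_lt with h | h
    · have := mem_iInter₂.1 h3 0 (by simp)
      simpa [← h] using this
    · have hab : 0 < b x - a x := by linarith [hs.2]
      have := mem_iInter₂.1 h3 ((s - a x) / (b x - a x))
        ⟨by rw [le_div_iff₀ hab]; linarith [hs.1], by rw [div_le_one hab]; linarith [hs.2]⟩
      simp only [mem_ofPred_eq, div_mul_cancel₀ _ hab.ne', add_sub_cancel] at this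
      exact this
  refine (isCompact_Icc (a := a x₀ - 1) (b := b x₀ + 1)).tendsto_nhds_of_unique_mapClusterPt ?_ ?_
  · filter_upwards [ha.continuousAt.eventually (lt_mem_nhds (show a x₀ - 1 < a x₀ by linarith)),
      hb.continuousAt.eventually (gt_mem_nhds (show b x₀ < b x₀ + 1 by linarith))] with x h1 h2
    exact ⟨h1.le.trans (hρ x).1, (hρ x).2.trans h2.le⟩
  · intro y _ hy
    refine hGρ x₀ y ?_
    rw [← hGc.closure_eq, mem_closure_iff_nhds]
    intro U hU
    rw [nhds_prod_eq] at hU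
    obtain ⟨V, hV, W, hW, hVW⟩ := Filter.mem_prod_iff.1 hU
    obtain ⟨x, hxW, hxV⟩ := ((mapClusterPt_iff_frequently.1 hy W hW).and_eventually hV).exists
    exact ⟨(x, ρ x), hVW ⟨hxV, hxW⟩, hρG x⟩

/-- On an interval without interior critical points, the absolute value of a polynomial has a unique
minimum point; it is an end point or a root. -/
theorem Polynomial.existsUnique_argmin_abs (P : Polynomial ℝ) {a b : ℝ} (hab : a ≤ b)
    (hP : ∀ t ∈ Ioo a b, P.derivative.eval t ≠ 0) :
    ∃ t ∈ Icc a b, (∀ s ∈ Icc a b, |P.eval t| ≤ |P.eval s|) ∧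
      (∀ t' ∈ Icc a b, (∀ s ∈ Icc a b, |P.eval t'| ≤ |P.eval s|) → t' = t) ∧
      (t = a ∨ t = b ∨ P.eval t = 0) := by
  obtain ⟨t, ht, hmin⟩ := isCompact_Icc.exists_isMinOn (nonempty_Icc.2 hab)
    (P.continuous.abs.continuousOn (s := Icc a b))
  have hinj : ∀ s ∈ Icc a b, ∀ t ∈ Icc a b, s < t → P.eval s ≠ P.eval t := by
    intro s hs t ht hst he
    obtain ⟨c, hc, hc0⟩ := exists_deriv_eq_zero hst P.continuous.continuousOn he
    rw [Polynomial.deriv] at hc0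
    exact hP c ⟨hs.1.trans_lt hc.1, hc.2.trans_le ht.2⟩ hc0
  -- Two minimum points have equal or opposite values. Opposite values force a root in between, so
  -- the minimum is 0 and the values agree after all, against the injectivity given by Rolle.
  have huniq : ∀ s ∈ Icc a b, ∀ t ∈ Icc a b, (∀ r ∈ Icc a b, |P.eval s| ≤ |P.eval r|) →
      (∀ r ∈ Icc a b, |P.eval t| ≤ |P.eval r|) → ¬ s < t := by
    intro s hs t ht hms hmt hst
    have he : |P.eval s| = |P.eval t| := le_antisymm (hms t ht) (hmt s hs)
    rcases abs_eq_abs.1 he with h | h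
    · exact hinj s hs t ht hst h
    · have h0 : (0 : ℝ) ∈ uIcc (P.eval s) (P.eval t) := by
        rw [h, mem_uIcc]
        rcases le_total 0 (P.eval t) with h | h
        · exact Or.inl ⟨by linarith, h⟩
        · exact Or.inr ⟨h, by linarith⟩
      obtain ⟨r, hr, hr0⟩ := intermediate_value_uIcc
        (P.continuous.continuousOn (s := uIcc s t)) h0
      rw [uIcc_of_le hst.le] at hr
      have h1 := hms r ⟨hs.1.trans hr.1, hr.2.trans ht.2⟩
      have h2 := hmt r ⟨hs.1.trans hr.1, hr.2.trans ht.2⟩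
      simp only [hr0, abs_zero, abs_nonpos_iff] at h1 h2
      exact hinj s hs t ht hst (h1.trans h2.symm)
  refine ⟨t, ht, fun s hs => hmin hs, fun t' ht' hm => ?_, ?_⟩
  · rcases lt_trichotomy t' t with h | h | h
    · exact (huniq t' ht' t ht hm (fun s hs => hmin hs) h).elim
    · exact h
    · exact (huniq t ht t' ht' (fun s hs => hmin hs) hm h).elim
  · by_contra! hne
    obtain ⟨hta, htb, ht0⟩ := hne
    have hI : t ∈ Ioo a b := ⟨ht.1.lt_of_ne' hta, ht.2.lt_of_ne htb⟩
    have hloc : IsLocalMin (fun s => P.eval s ^ 2) t := by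
      filter_upwards [Icc_mem_nhds hI.1 hI.2] with s hs
      exact sq_le_sq.2 (hmin hs)
    have hd : HasDerivAt (fun s => P.eval s ^ 2) (2 * P.eval t * P.derivative.eval t) t := by
      simpa using (P.hasDerivAt t).fun_pow 2
    have := hloc.hasDerivAt_eq_zero hd
    simp [ht0, hP t hI] at this

theorem exists_mem_Icc_succ {c : ℕ → ℝ} {m : ℕ} {t : ℝ} (h0 : c 0 ≤ t) (hm : t ≤ c m)
    (hm0 : 0 < m) : ∃ i < m, t ∈ Icc (c i) (c (i + 1)) := by
  induction m, hm0 using Nat.le_induction with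
  | base => exact ⟨0, by simp, h0, hm⟩
  | succ k hk ih =>
    rcases le_total t (c k) with h | h
    · obtain ⟨i, hi, ht⟩ := ih h
      exact ⟨i, by lia, ht⟩
    · exact ⟨k, by lia, h, hm⟩

theorem continuous_eval_map {n : ℕ} (p : Polynomial (MvPolynomial (Fin n) ℝ)) :
    Continuous fun z : (Fin n → ℝ) × ℝ => (p.map (MvPolynomial.eval z.1)).eval z.2 := by
  simp only [Polynomial.eval_map, Polynomial.eval₂_eq_sum_range]
  exact continuous_finsetSum _ fun i _ =>
    ((MvPolynomial.continuous_eval _).comp continuous_fst).mul (continuous_snd.pow i)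

/-- The real roots of a monic polynomial with polynomial coefficients, in a bounded interval, are
among finitely many continuous integral functions, in increasing order. -/
theorem exists_root_functions {n : ℕ} {M : ℝ} (hM : 0 ≤ M) (d : ℕ)
    (p : Polynomial (MvPolynomial (Fin n) ℝ)) (hp : p.Monic) (hd : p.natDegree = d) :
    ∃ (m : ℕ) (c : ℕ → (Fin n → ℝ) → ℝ), 0 < m ∧ (∀ i, IsPolyIntegral (c i)) ∧
      (∀ x, c 0 x = -M) ∧ (∀ i, m ≤ i → ∀ x, c i x = M) ∧ (∀ x, Monotone fun i => c i x) ∧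
      ∀ x t i, c i x < t → t < c (i + 1) x → (p.map (MvPolynomial.eval x)).eval t ≠ 0 := by
  induction d generalizing p with
  | zero =>
    rw [hp.natDegree_eq_zero] at hd
    refine ⟨1, fun i _ => if i = 0 then -M else M, one_pos, fun i => IsPolyIntegral.const _,
      by simp, fun i hi x => by simp [show i ≠ 0 by lia], fun x => ?_, by simp [hd]⟩
    refine monotone_nat_of_le_succ fun i => ?_
    rcases eq_or_ne i 0 with h | h
    · simp [h]; linarith
    · simp [h]
  | succ d ih =>
    have hpos : ((d : ℝ) + 1) ≠ 0 := by positivity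
    have hcoeff : p.derivative.coeff d = MvPolynomial.C ((d : ℝ) + 1) := by
      have : p.coeff (d + 1) = 1 := by rw [← hd]; exact hp
      simp [Polynomial.coeff_derivative, this]
    have hdeg : p.derivative.natDegree = d :=
      Polynomial.natDegree_eq_of_le_of_coeff_ne_zero
        ((Polynomial.natDegree_derivative_le p).trans (by lia))
        (by rw [hcoeff]; exact MvPolynomial.C_eq_zero.not.2 hpos)
    have hlead : p.derivative.leadingCoeff = MvPolynomial.C ((d : ℝ) + 1) := by
      rw [Polynomial.leadingCoeff, hdeg, hcoeff]
    obtain ⟨m, c, hm, hc, hc0, hcm, hmono, hroot⟩ := ih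
      (Polynomial.C (MvPolynomial.C ((d : ℝ) + 1)⁻¹) * p.derivative)
      (Polynomial.monic_C_mul_of_mul_leadingCoeff_eq_one (by
        rw [hlead, ← MvPolynomial.C_mul, inv_mul_cancel₀ hpos, MvPolynomial.C_1]))
      (by
        rw [Polynomial.natDegree_C_mul_of_mul_ne_zero, hdeg]
        rw [hlead, ← MvPolynomial.C_mul, inv_mul_cancel₀ hpos, MvPolynomial.C_1]
        exact one_ne_zero)
    have hroot' : ∀ x i, ∀ t ∈ Ioo (c i x) (c (i + 1) x),
        (p.map (MvPolynomial.eval x)).derivative.eval t ≠ 0 := by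
      intro x i t ht h0
      refine hroot x t i ht.1 ht.2 ?_
      rw [Polynomial.map_mul, Polynomial.eval_mul, ← Polynomial.derivative_map, h0, mul_zero]
    -- Between consecutive root functions of the derivative, ρ i is the root of p if there is one,
    -- and an end point otherwise. It is thus defined and continuous even where real roots
    -- disappear, and it is a root of the monic (T - c i)(T - c (i + 1)) p.
    choose ρ hρI hρmin hρuniq hρroot using fun i x =>
      Polynomial.existsUnique_argmin_abs (p.map (MvPolynomial.eval x))
        (hmono x (Nat.le_succ i)) (hroot' x i)
    have hρcont : ∀ i, Continuous (ρ i) := fun i =>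
      continuous_of_unique_argmin (F := fun x t => |(p.map (MvPolynomial.eval x)).eval t|)
        (continuous_eval_map p).abs (hc i).1 (hc (i + 1)).1 (hρI i) (hρmin i) (hρuniq i)
    have hρint : ∀ i, IsPolyIntegral (ρ i) := by
      intro i
      refine IsPolyIntegral.of_monic (hρcont i)
        ((Polynomial.X - Polynomial.C ⟨c i, (hc i).2⟩) *
          (Polynomial.X - Polynomial.C ⟨c (i + 1), (hc (i + 1)).2⟩) *
          p.map ((polyFun n).codRestrict (integralFun n) polyFun_mem_integralFun))
        (((Polynomial.monic_X_sub_C _).mul (Polynomial.monic_X_sub_C _)).mul (hp.map _))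
        fun x => ?_
      rw [Polynomial.eval₂_mul, Polynomial.eval₂_map, Polynomial.eval₂_mul]
      rcases hρroot i x with h | h | h
      · simp [h]
      · simp [h]
      · rw [Polynomial.eval_map] at h
        convert! mul_zero _
    have hρM : ∀ i, m ≤ i → ∀ x, ρ i x = M := fun i hi x => by
      have := hρI i x
      simp only at this
      rw [hcm i hi x, hcm (i + 1) (by lia) x] at this
      exact le_antisymm this.2 this.1
    have hmono' : ∀ x, Monotone fun i => (Nat.casesOn i (-M) fun j => ρ j x : ℝ) := by
      refine fun x => monotone_nat_of_le_succ fun i => ?_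
      cases i with
      | zero => exact (hc0 x) ▸ ((hmono x (Nat.zero_le 0)).trans (hρI 0 x).1)
      | succ i => exact (hρI i x).2.trans (hρI (i + 1) x).1
    refine ⟨m + 1, fun i x => Nat.casesOn i (-M) fun j => ρ j x, by lia, ?_, fun x => rfl, ?_,
      hmono', ?_⟩
    · rintro (_ | i)
      · exact IsPolyIntegral.const _
      · exact hρint i
    · rintro (_ | i) hi x
      · lia
      · exact hρM i (by lia) x
    · intro x t i h1 h2 h0
      have ht0 : c 0 x ≤ t := by
        rw [hc0]; exact (hmono' x (Nat.zero_le i)).trans h1.le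
      have htm : t ≤ c m x := by
        have := (hρI i x).2.trans (hmono x (le_max_left (i + 1) m))
        simp only [hcm _ (le_max_right (i + 1) m)] at this
        rw [hcm m le_rfl]
        exact h2.le.trans this
      obtain ⟨j, _, hj⟩ := exists_mem_Icc_succ (c := fun i => c i x) ht0 htm hm
      -- A root in the j-th interval minimizes |p|, so it is the term of index j + 1 of the new
      -- sequence and cannot lie strictly between consecutive terms.
      have htj : t = ρ j x := hρuniq j x t hj fun s _ => by rw [h0, abs_zero]; exact abs_nonneg _
      rcases lt_or_ge j i with hji | hji
      · exact absurd ((hmono' x (Nat.succ_le_of_lt hji)).trans_lt h1) (by simp [htj])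
      · exact absurd (h2.trans_le (hmono' x (Nat.succ_le_succ hji))) (by simp [htj])

/-! ### Making a polynomial monic in the first variable -/

/-- Substituting linear polynomials in `T` for the variables of a polynomial `q` of degree at most
`d` gives a polynomial of degree at most `d`, and the coefficient of `T ^ d` is the value of the
homogeneous component of `q` at the linear coefficients. -/
theorem natDegree_coeff_eval₂_linear {σ A : Type*} [Fintype σ] [CommRing A]
    (φ : ℝ →+* A) (L : σ → Polynomial A) (v : σ → ℝ) (hL : ∀ i, (L i).natDegree ≤ 1)
    (hv : ∀ i, (L i).coeff 1 = φ (v i)) (q : MvPolynomial σ ℝ) {d : ℕ} (hd : q.totalDegree ≤ d) :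
    (q.eval₂ (Polynomial.C.comp φ) L).natDegree ≤ d ∧
      (q.eval₂ (Polynomial.C.comp φ) L).coeff d =
        φ (MvPolynomial.eval v (MvPolynomial.homogeneousComponent d q)) := by
  classical
  have hprod : ∀ (m : σ →₀ ℕ) (s : Finset σ), (∏ i ∈ s, L i ^ m i).natDegree ≤ ∑ i ∈ s, m i ∧
      (∏ i ∈ s, L i ^ m i).coeff (∑ i ∈ s, m i) = φ (∏ i ∈ s, v i ^ m i) := by
    intro m s
    induction s using Finset.induction_on with
    | empty => simp
    | insert i s hi ih =>
      have h1 : (L i ^ m i).natDegree ≤ m i := by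
        simpa using Polynomial.natDegree_pow_le_of_le (m i) (hL i)
      have h2 : (L i ^ m i).coeff (m i) = φ (v i) ^ m i := by
        have := Polynomial.coeff_pow_of_natDegree_le (n := 1) (m := m i) (hL i)
        rwa [mul_one, hv] at this
      rw [Finset.prod_insert hi, Finset.prod_insert hi, Finset.sum_insert hi]
      refine ⟨Polynomial.natDegree_mul_le_of_le h1 ih.1, ?_⟩
      rw [Polynomial.coeff_mul_add_eq_of_natDegree_le h1 ih.1, h2, ih.2, map_mul, map_pow]
  have hle : ∀ m ∈ q.support, ∑ i, m i ≤ d := fun m hm => by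
    refine le_trans ?_ hd
    rw [← Finsupp.degree_eq_sum]
    exact MvPolynomial.le_totalDegree hm
  rw [MvPolynomial.eval₂_eq']
  constructor
  · refine Polynomial.natDegree_sum_le_of_forall_le _ _ fun m hm => ?_
    exact (Polynomial.natDegree_C_mul_le _ _).trans ((hprod m Finset.univ).1.trans (hle m hm))
  · rw [MvPolynomial.homogeneousComponent_apply, Polynomial.finsetSum_coeff, map_sum, map_sum,
      Finset.sum_filter]
    refine Finset.sum_congr rfl fun m hm => ?_
    rw [RingHom.comp_apply, Polynomial.coeff_C_mul]
    split_ifs with h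
    · have h' : ∑ i, m i = d := by rw [← Finsupp.degree_eq_sum]; exact h
      rw [← h', (hprod m Finset.univ).2, MvPolynomial.eval_monomial, map_mul,
        Finsupp.prod_fintype _ _ (by simp)]
    · have h' : ∑ i, m i < d :=
        (hle m hm).lt_of_ne fun h' => h (by rw [← h', ← Finsupp.degree_eq_sum])
      rw [Polynomial.coeff_eq_zero_of_natDegree_lt ((hprod m Finset.univ).1.trans_lt h'), mul_zero]

/-- After a linear change of coordinates, a nonzero polynomial is monic in the first variable, up to
a nonzero constant. -/
theorem exists_homeomorph_monic {n : ℕ} {q : MvPolynomial (Fin (n + 1)) ℝ} (hq : q ≠ 0) :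
    ∃ (Φ : (Fin (n + 1) → ℝ) ≃ₜ (Fin (n + 1) → ℝ)) (p : Polynomial (MvPolynomial (Fin n) ℝ)),
      (∀ i, IsPolyIntegral fun y => Φ y i) ∧ p.Monic ∧
      ∀ y, (p.map (MvPolynomial.eval (Fin.tail y))).eval (y 0) ≠ 0 →
        MvPolynomial.eval (Φ y) q ≠ 0 := by
  -- The top homogeneous part at v becomes the leading coefficient; the factor X 0 ensures v 0 ≠ 0,
  -- so that the coordinate change is invertible.
  obtain ⟨v, hv⟩ : ∃ v : Fin (n + 1) → ℝ, MvPolynomial.eval v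
      (MvPolynomial.X 0 * MvPolynomial.homogeneousComponent q.totalDegree q) ≠ 0 := by
    by_contra! h
    have h0 : MvPolynomial.X 0 * MvPolynomial.homogeneousComponent q.totalDegree q = 0 :=
      MvPolynomial.funext fun x => by simpa using h x
    rcases mul_eq_zero.1 h0 with h1 | h1
    · exact MvPolynomial.X_ne_zero _ h1
    · obtain ⟨m, hm, hmd⟩ := Finset.exists_mem_eq_sup q.support
        (MvPolynomial.support_nonempty.2 hq) fun m => m.sum fun _ e => e
      have h2 := congrArg (MvPolynomial.coeff m) h1
      rw [MvPolynomial.coeff_homogeneousComponent, MvPolynomial.coeff_zero, if_pos] at h2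
      · exact MvPolynomial.mem_support_iff.1 hm h2
      · exact hmd.symm
  rw [map_mul, MvPolynomial.eval_X] at hv
  have hv0 : v 0 ≠ 0 := left_ne_zero_of_mul hv
  have hvq := right_ne_zero_of_mul hv
  set c := MvPolynomial.eval v (MvPolynomial.homogeneousComponent q.totalDegree q) with hc
  let L : Fin (n + 1) → Polynomial (MvPolynomial (Fin n) ℝ) :=
    Fin.cons (Polynomial.C (MvPolynomial.C (v 0)) * Polynomial.X) fun i =>
      Polynomial.C (MvPolynomial.C (v i.succ)) * Polynomial.X + Polynomial.C (MvPolynomial.X i)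
  obtain ⟨h1, h2⟩ := natDegree_coeff_eval₂_linear (MvPolynomial.C (R := ℝ) (σ := Fin n)) L v
    (fun i => by
      refine Fin.cases ?_ (fun i => ?_) i
      · exact (Polynomial.natDegree_C_mul_le _ _).trans Polynomial.natDegree_X_le
      · exact Polynomial.natDegree_linear_le)
    (fun i => by
      refine Fin.cases ?_ (fun i => ?_) i
      · simp [L]
      · simp [L, Polynomial.coeff_C]) q le_rfl
  set P := q.eval₂ (Polynomial.C.comp MvPolynomial.C) L with hP
  let Φ : (Fin (n + 1) → ℝ) ≃ₜ (Fin (n + 1) → ℝ) :=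
    { toFun := fun y => Fin.cons (v 0 * y 0) fun i => v i.succ * y 0 + y i.succ
      invFun := fun z => Fin.cons (z 0 / v 0) fun i => z i.succ - v i.succ * (z 0 / v 0)
      left_inv := fun y => by
        funext i
        refine Fin.cases ?_ (fun i => ?_) i
        · simp [hv0]
        · simp [hv0]
      right_inv := fun z => by
        funext i
        refine Fin.cases ?_ (fun i => ?_) i
        · simp; field_simp
        · simp
      continuous_toFun := continuous_pi fun i => by
        refine Fin.cases ?_ (fun i => ?_) i
        · simp only [Fin.cons_zero]; fun_prop
        · simp only [Fin.cons_succ]; fun_prop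
      continuous_invFun := continuous_pi fun i => by
        refine Fin.cases ?_ (fun i => ?_) i
        · simp only [Fin.cons_zero]; fun_prop
        · simp only [Fin.cons_succ]; fun_prop }
  have hΦ0 : ∀ y, Φ y 0 = v 0 * y 0 := fun y => rfl
  have hΦs : ∀ y (i : Fin n), Φ y i.succ = v i.succ * y 0 + y i.succ := fun y i => rfl
  refine ⟨Φ, Polynomial.C (MvPolynomial.C c⁻¹) * P, fun i => ?_, ?_, fun y hy h0 => hy ?_⟩
  · refine Fin.cases ?_ (fun i => ?_) i
    · exact (IsPolyIntegral.const _).mul (IsPolyIntegral.coord 0)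
    · exact ((IsPolyIntegral.const _).mul (IsPolyIntegral.coord 0)).add (IsPolyIntegral.coord _)
  · have hdeg : P.natDegree = q.totalDegree :=
      Polynomial.natDegree_eq_of_le_of_coeff_ne_zero h1
        (by rw [h2]; exact MvPolynomial.C_eq_zero.not.2 hvq)
    refine Polynomial.monic_C_mul_of_mul_leadingCoeff_eq_one ?_
    rw [Polynomial.leadingCoeff, hdeg, h2, ← MvPolynomial.C_mul, inv_mul_cancel₀ hvq,
      MvPolynomial.C_1]
  · have key : (P.map (MvPolynomial.eval (Fin.tail y))).eval (y 0) =
        MvPolynomial.eval (Φ y) q := by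
      let θ : Polynomial (MvPolynomial (Fin n) ℝ) →+* ℝ :=
        (Polynomial.evalRingHom (y 0)).comp
          (Polynomial.mapRingHom (MvPolynomial.eval (Fin.tail y)))
      change θ P = _
      rw [hP, MvPolynomial.hom_eval₂, MvPolynomial.eval, MvPolynomial.coe_eval₂Hom]
      congr 1
      · ext r; simp [θ]
      · funext i
        refine Fin.cases ?_ (fun i => ?_) i
        · simp [θ, L, hΦ0]
        · simp [θ, L, hΦs, Fin.tail]
    rw [Polynomial.map_mul, Polynomial.eval_mul, key, h0, mul_zero]

/-! ### Compact zero sets, by induction on the dimension -/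

theorem IsPolyIntegral.comp_cons {n : ℕ} {h : (Fin (n + 1) → ℝ) → ℝ} (hh : IsPolyIntegral h)
    {c : (Fin n → ℝ) → ℝ} (hc : IsPolyIntegral c) :
    IsPolyIntegral fun x => h (Fin.cons (c x) x) := by
  have := hh.comp (s := Fin.cons c fun i x => x i) fun i => by
    refine Fin.cases ?_ (fun i => ?_) i
    · exact hc
    · exact IsPolyIntegral.coord i
  convert this using 3 with x
  funext i
  refine Fin.cases ?_ (fun i => ?_) i <;> simp

theorem add_sq_eq_zero_iff {a b : ℝ} (ha : 0 ≤ a) : a + b ^ 2 = 0 ↔ a = 0 ∧ b = 0 := by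
  rw [add_eq_zero_iff_of_nonneg ha (sq_nonneg b), pow_eq_zero_iff two_ne_zero]

/-- Compact zero sets of continuous integral functions are absolute neighbourhood extensors, if
this holds in dimension one less, and the function is regular in the first variable. -/
theorem isANE_zeros_succ {n : ℕ}
    (ih : ∀ g : (Fin n → ℝ) → ℝ, IsPolyIntegral g → IsCompact {x | g x = 0} →
      IsANE {x | g x = 0})
    {h k : (Fin (n + 1) → ℝ) → ℝ} (hh : IsPolyIntegral h) (hc : IsCompact {y | h y = 0})
    (hk : Continuous k) (hhk : ∀ y, h y = 0 ∨ k y = 0) (p : Polynomial (MvPolynomial (Fin n) ℝ))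
    (hp : p.Monic) (hpk : ∀ y, (p.map (MvPolynomial.eval (Fin.tail y))).eval (y 0) ≠ 0 →
      h y = 0 → k y ≠ 0) : IsANE {y | h y = 0} := by
  obtain ⟨M, hM⟩ := hc.isBounded.exists_norm_le
  set R := max M 0 with hR
  have hbd : ∀ y, h y = 0 → y 0 ∈ Icc (-R) R := fun y hy =>
    abs_le.1 (((norm_le_pi_norm y 0).trans (hM y hy)).trans (le_max_left _ _))
  obtain ⟨m, c, hm, hcI, hc0, hcm, hmono, hroot⟩ :=
    exists_root_functions (le_max_right M 0) _ p hp rfl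
  -- the family of all compact bands over zero sets
  let 𝒞 : Set (Set (Fin (n + 1) → ℝ)) := {B | ∃ g a b : (Fin n → ℝ) → ℝ, IsPolyIntegral g ∧
    IsPolyIntegral a ∧ IsPolyIntegral b ∧ (∀ x, g x = 0 → a x ≤ b x) ∧ IsCompact {x | g x = 0} ∧
    B = band {x | g x = 0} a b}
  have hclosed : ∀ g : (Fin n → ℝ) → ℝ, IsPolyIntegral g → IsClosed {x | g x = 0} := fun g hg =>
    isClosed_eq hg.1 continuous_const
  have hcl : ∀ B ∈ 𝒞, IsClosed B := by
    rintro _ ⟨g, a, b, hg, ha, hb, -, -, rfl⟩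
    exact isClosed_band (hclosed g hg) ha.1 hb.1
  have hane : ∀ B ∈ 𝒞, IsANE B := by
    rintro _ ⟨g, a, b, hg, ha, hb, hab, hgc, rfl⟩
    exact (ih g hg hgc).band ha.1 hb.1 hab
  have hmin : ∀ {f g : (Fin n → ℝ) → ℝ}, IsPolyIntegral f → IsPolyIntegral g →
      IsPolyIntegral fun x => min (f x) (g x) := fun {f g} hf hg => by
    have := (hf.add hg).sub (hf.max hg)
    convert this using 2 with x
    linarith [min_add_max (f x) (g x)]
  have hinter : ∀ B ∈ 𝒞, ∀ C ∈ 𝒞, B ∩ C ∈ 𝒞 := by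
    rintro _ ⟨g, a, b, hg, ha, hb, hab, hgc, rfl⟩ _ ⟨g', a', b', hg', ha', hb', hab', hgc', rfl⟩
    -- The last square restricts the base of the intersection to the points where the lower bound
    -- does not exceed the upper one.
    have hG : ∀ x, g x ^ 2 + g' x ^ 2 +
        (max (max (a x) (a' x) - min (b x) (b' x)) 0) ^ 2 = 0 ↔
        g x = 0 ∧ g' x = 0 ∧ max (a x) (a' x) ≤ min (b x) (b' x) := by
      intro x
      rw [add_sq_eq_zero_iff (add_nonneg (sq_nonneg _) (sq_nonneg _)),
        add_sq_eq_zero_iff (sq_nonneg _), pow_eq_zero_iff two_ne_zero, max_eq_right_iff,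
        sub_nonpos, and_assoc]
    have hI : IsPolyIntegral fun x => g x ^ 2 + g' x ^ 2 +
        (max (max (a x) (a' x) - min (b x) (b' x)) 0) ^ 2 :=
      ((hg.pow 2).add (hg'.pow 2)).add
        ((((ha.max ha').sub (hmin hb hb')).max (IsPolyIntegral.const 0)).pow 2)
    refine ⟨_, _, _, hI, ha.max ha', hmin hb hb', fun x hx => ((hG x).1 hx).2.2,
      hgc.of_isClosed_subset (hclosed _ hI) fun x hx => ((hG x).1 hx).1, ?_⟩
    ext y
    constructor
    · rintro ⟨⟨h1, h2, h3⟩, h4, h5, h6⟩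
      exact ⟨(hG _).2 ⟨h1, h4, (max_le h2 h5).trans (le_min h3 h6)⟩, max_le h2 h5, le_min h3 h6⟩
    · rintro ⟨h1, h2, h3⟩
      obtain ⟨e1, e2, -⟩ := (hG _).1 h1
      exact ⟨⟨e1, (max_le_iff.1 h2).1, (le_min_iff.1 h3).1⟩,
        e2, (max_le_iff.1 h2).2, (le_min_iff.1 h3).2⟩
  -- `h` vanishes identically or nowhere between consecutive roots
  have hconn : ∀ x i, ∀ s ∈ Ioo (c i x) (c (i + 1) x), h (Fin.cons s x) = 0 →
      ∀ t ∈ Icc (c i x) (c (i + 1) x), h (Fin.cons t x) = 0 := by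
    intro x i s hs hs0
    have hcons : Continuous fun t : ℝ => (Fin.cons t x : Fin (n + 1) → ℝ) :=
      continuous_pi fun j => by
        refine Fin.cases ?_ (fun j => ?_) j
        · simp only [Fin.cons_zero]; fun_prop
        · simp only [Fin.cons_succ]; fun_prop
    have hF : IsClosed {t : ℝ | h (Fin.cons t x) = 0} :=
      isClosed_eq (hh.1.comp hcons) continuous_const
    have hK : IsClosed {t : ℝ | k (Fin.cons t x) = 0} :=
      isClosed_eq (hk.comp hcons) continuous_const
    have hsub : Ioo (c i x) (c (i + 1) x) ⊆ {t : ℝ | h (Fin.cons t x) = 0} := by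
      intro t ht
      by_contra h0
      -- The zero sets of h and k cover the open interval and are disjoint there, as p has no root
      -- in it; connectedness excludes that both are met.
      obtain ⟨r, hr, hr1, hr2⟩ := isPreconnected_closed_iff.1 isPreconnected_Ioo _ _ hF hK
        (fun r _ => hhk _) ⟨s, hs, hs0⟩ ⟨t, ht, (hhk _).resolve_left h0⟩
      exact hpk (Fin.cons r x) (by simpa using hroot x r i hr.1 hr.2) hr1 hr2
    have := closure_minimal hsub hF
    rw [closure_Ioo (hs.1.trans hs.2).ne] at this
    exact this
  let G : ℕ → (Fin n → ℝ) → ℝ := fun i x => h (Fin.cons (c i x) x)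
  -- By `hconn`, vanishing at the midpoint decides the whole interval. The summand from G covers
  -- degenerate intervals and bounds the zero set of T.
  let T : ℕ → (Fin n → ℝ) → ℝ := fun i x =>
    G i x ^ 2 + h (Fin.cons (2⁻¹ * (c i x + c (i + 1) x)) x) ^ 2
  have hGI : ∀ i, IsPolyIntegral (G i) := fun i => hh.comp_cons (hcI i)
  have hTI : ∀ i, IsPolyIntegral (T i) := fun i => ((hGI i).pow 2).add
    ((hh.comp_cons ((IsPolyIntegral.const 2⁻¹).mul ((hcI i).add (hcI (i + 1))))).pow 2)
  have hT : ∀ i x, T i x = 0 ↔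
      G i x = 0 ∧ h (Fin.cons (2⁻¹ * (c i x + c (i + 1) x)) x) = 0 := by
    intro i x
    simp only [T]
    rw [add_sq_eq_zero_iff (sq_nonneg _), pow_eq_zero_iff two_ne_zero]
  have hGc : ∀ i, IsCompact {x | G i x = 0} := fun i =>
    (hc.image continuous_tail).of_isClosed_subset (hclosed _ (hGI i))
      fun x hx => ⟨Fin.cons (c i x) x, hx, Fin.tail_cons _ _⟩
  have hTc : ∀ i, IsCompact {x | T i x = 0} := fun i =>
    (hGc i).of_isClosed_subset (hclosed _ (hTI i)) fun x hx => ((hT i x).1 hx).1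
  let C : ℕ × Bool → Set (Fin (n + 1) → ℝ) := fun z =>
    if z.2 then band {x | T z.1 x = 0} (c z.1) (c (z.1 + 1)) else band {x | G z.1 x = 0} (c z.1) (c z.1)
  have hC : ∀ z, C z ∈ 𝒞 := by
    rintro ⟨i, b⟩
    cases b
    · exact ⟨G i, c i, c i, hGI i, hcI i, hcI i, fun _ _ => le_rfl, hGc i, rfl⟩
    · exact ⟨T i, c i, c (i + 1), hTI i, hcI i, hcI _, fun x _ => hmono x (Nat.le_succ i), hTc i,
        rfl⟩
  have hunion : {y | h y = 0} = ⋃ z ∈ Finset.range (m + 1) ×ˢ Finset.univ, C z := by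
    ext y
    simp only [mem_iUnion, exists_prop]
    constructor
    · intro hy
      have hb := hbd y hy
      set x := Fin.tail y with hx
      have hyx : Fin.cons (y 0) x = y := Fin.cons_self_tail y
      have hy' : h (Fin.cons (y 0) x) = 0 := by rw [hyx]; exact hy
      have hgraph : ∀ i ≤ m, y 0 = c i x → ∃ z ∈ Finset.range (m + 1) ×ˢ Finset.univ, y ∈ C z :=
        fun i hi he => ⟨(i, false), by simp; lia,
          show h (Fin.cons (c i x) x) = 0 from he ▸ hy', he.symm.le, he.le⟩
      obtain ⟨i, hi, hyi⟩ := exists_mem_Icc_succ (c := fun i => c i x) (t := y 0)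
        (by rw [hc0]; exact hb.1) (by rw [hcm m le_rfl]; exact hb.2) hm
      rcases hyi.1.eq_or_lt with h1 | h1
      · exact hgraph i hi.le h1.symm
      rcases hyi.2.eq_or_lt with h2 | h2
      · exact hgraph (i + 1) hi h2
      have hz := hconn x i (y 0) ⟨h1, h2⟩ hy'
      refine ⟨(i, true), by simp; lia, (hT i x).2 ⟨hz _ ⟨le_rfl, (h1.trans h2).le⟩, hz _ ⟨?_, ?_⟩⟩,
        hyi.1, hyi.2⟩
      · linarith
      · linarith
    · rintro ⟨⟨i, b⟩, -, hy⟩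
      set x := Fin.tail y with hx
      have hyx : Fin.cons (y 0) x = y := Fin.cons_self_tail y
      rw [mem_ofPred_eq, ← hyx]
      cases b
      · obtain ⟨h1, h2, h3⟩ := hy
        rw [le_antisymm h3 h2]
        exact h1
      · obtain ⟨h1, h2, h3⟩ := hy
        obtain ⟨e1, e2⟩ := (hT i x).1 h1
        rcases (h2.trans h3).eq_or_lt with he | hlt
        · rw [le_antisymm (h3.trans he.symm.le) h2]
          exact e1
        · exact hconn x i _ ⟨by linarith, by linarith⟩ e2 _ ⟨h2, h3⟩
  rw [hunion]
  exact IsANE.biUnion 𝒞 hcl hane hinter _ C fun z _ => hC z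

/-- A compact zero set of a continuous function that is integral over the polynomials is an absolute
neighbourhood extensor. -/
theorem IsPolyIntegral.isANE_zeros {n : ℕ} {h : (Fin n → ℝ) → ℝ} (hh : IsPolyIntegral h)
    (hc : IsCompact {x | h x = 0}) : IsANE {x | h x = 0} := by
  induction n with
  | zero =>
    rcases (Set.subsingleton_of_subsingleton (s := {x | h x = 0})).eq_empty_or_singleton with
      he | ⟨x, he⟩
    · rw [he]; exact IsANE.empty
    · rw [he]; exact IsANE.singleton x
  | succ n ih =>
    obtain ⟨q, k, hq, hk, hhk, hqk⟩ := hh.exists_complement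
    obtain ⟨Φ, p, hΦ, hp, hpq⟩ := exists_homeomorph_monic hq
    have hpre : {y | h (Φ y) = 0} = Φ.symm '' {x | h x = 0} := by
      rw [Φ.symm.image_eq_preimage_symm]; rfl
    have h1 : IsANE {y | h (Φ y) = 0} :=
      isANE_zeros_succ (fun g hg hgc => ih hg hgc) (hh.comp hΦ)
        (by rw [hpre]; exact hc.image Φ.symm.continuous) (hk.comp Φ.continuous)
        (fun y => hhk _) p hp fun y hy => hqk _ (hpq y hy)
    have h2 := h1.image_homeomorph Φ
    rwa [hpre, ← image_comp, Φ.self_comp_symm, image_id] at h2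

/-! ### Factoring maps through compact polyhedra -/

/-- Barycentric coordinates with respect to finitely many points factor a map through a
polyhedron. -/
theorem exists_polyhedron_of_barycentric {X : Type u} [TopologicalSpace X]
    {F : Type*} [NormedAddCommGroup F] [NormedSpace ℝ F] {N : ℕ} (v : Fin N → F)
    (w : Fin N → C(X, ℝ)) (W : Set F) (hw0 : ∀ k x, 0 ≤ w k x) (hw1 : ∀ x, ∑ k, w k x = 1)
    (hW : ∀ x, convexHull ℝ (v '' {k | 0 < w k x}) ⊆ W) :
    ∃ (P : CompHausLike.{u} IsCompactPolyhedron) (a : C(X, P)) (b : C(P, F)),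
      (∀ p, b p ∈ W) ∧ ∀ x, b (a x) = ∑ k, w k x • v k := by
  classical
  let e : Fin N → EuclideanSpace ℝ (Fin N) := fun k => EuclideanSpace.single k 1
  have he : AffineIndependent ℝ e := by
    have hb : e = (EuclideanSpace.basisFun (Fin N) ℝ).toBasis := by
      funext k
      simp [e]
    rw [hb]
    exact (EuclideanSpace.basisFun (Fin N) ℝ).toBasis.linearIndependent.affineIndependent
  let π : EuclideanSpace ℝ (Fin N) →ₗ[ℝ] F :=
    { toFun := fun y => ∑ k, y k • v k
      map_add' := fun y z => by simp [add_smul, Finset.sum_add_distrib]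
      map_smul' := fun c y => by simp [mul_smul, Finset.smul_sum] }
  have hπ : ∀ y, π y = ∑ k, y k • v k := fun y => rfl
  have hπe : ∀ k, π (e k) = v k := fun k => by simp [hπ, e]
  have hindep : ∀ s : Finset (EuclideanSpace ℝ (Fin N)), ↑s ⊆ range e →
      AffineIndependent ℝ ((↑) : s → EuclideanSpace ℝ (Fin N)) := fun s hs =>
    he.range.mono hs
  -- Of the standard simplex only the faces mapped into W are kept. The weights at x lie in the face
  -- of their positive coordinates, which `hW` admits.
  let K : Geometry.SimplicialComplex ℝ (EuclideanSpace ℝ (Fin N)) :=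
    { faces := {s | s.Nonempty ∧ ↑s ⊆ range e ∧ convexHull ℝ (π '' s) ⊆ W}
      isRelLowerSet_faces := fun s hs => ⟨hs.1, fun t hts ht => ⟨ht,
        (Finset.coe_subset.2 hts).trans hs.2.1,
        (convexHull_mono (image_mono (Finset.coe_subset.2 hts))).trans hs.2.2⟩⟩
      indep := fun hs => hindep _ hs.2.1
      inter_subset_convexHull := fun {s t} hs ht => by
        have := AffineIndependent.convexHull_inter' (R := ℝ) (t₁ := s) (t₂ := t)
          (hindep (s ∪ t) (by rw [Finset.coe_union]; exact union_subset hs.2.1 ht.2.1))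
        exact this.ge }
  have hKfin : K.faces.Finite := by
    refine (Finset.finite_toSet (Finset.univ.image e).powerset).subset fun s hs => ?_
    rw [Finset.mem_coe, Finset.mem_powerset, ← Finset.coe_subset]
    simpa using hs.2.1
  have hKc : IsCompact K.space :=
    hKfin.isCompact_biUnion fun s _ => s.finite_toSet.isCompact_convexHull ℝ
  have hKW : ∀ y ∈ K.space, π y ∈ W := by
    intro y hy
    obtain ⟨s, hs, hys⟩ := Geometry.SimplicialComplex.mem_space_iff.1 hy
    apply hs.2.2
    rw [← π.image_convexHull]
    exact ⟨y, hys, rfl⟩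
  have hwK : ∀ x, WithLp.toLp 2 (fun k => w k x) ∈ K.space := by
    intro x
    let s : Finset (EuclideanSpace ℝ (Fin N)) := (Finset.univ.filter fun k => 0 < w k x).image e
    have hsum : ∑ k with 0 < w k x, w k x = 1 := by
      rw [← hw1 x]
      exact Finset.sum_filter_of_ne fun k _ hk => (hw0 k x).lt_of_ne' hk
    have hs : s ∈ K.faces := by
      refine ⟨?_, ?_, ?_⟩
      · refine Finset.Nonempty.image ?_ _
        by_contra h
        rw [Finset.not_nonempty_iff_eq_empty.1 h, Finset.sum_empty] at hsum
        exact zero_ne_one hsum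
      · simp [s]
      · refine Subset.trans (convexHull_mono ?_) (hW x)
        rintro _ ⟨_, hy, rfl⟩
        obtain ⟨k, hk, rfl⟩ := Finset.mem_image.1 (Finset.mem_coe.1 hy)
        exact ⟨k, (Finset.mem_filter.1 hk).2, (hπe k).symm⟩
    refine Geometry.SimplicialComplex.mem_space_iff.2 ⟨s, hs, ?_⟩
    have hx : WithLp.toLp 2 (fun k => w k x) = ∑ k with 0 < w k x, w k x • e k := by
      rw [Finset.sum_filter_of_ne fun k _ hk => (hw0 k x).lt_of_ne' fun h => hk (by simp [h])]
      ext j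
      simp [e, Finset.sum_apply, Pi.single_apply]
    rw [hx]
    exact (convex_convexHull ℝ _).sum_mem (fun k _ => hw0 k x) hsum fun k hk =>
      subset_convexHull ℝ _ (Finset.mem_coe.2 (Finset.mem_image_of_mem e hk))
  have : CompactSpace K.space := isCompact_iff_compactSpace.1 hKc
  let P : CompHausLike.{u} IsCompactPolyhedron :=
    { toTop := TopCat.of (ULift.{u} K.space)
      prop := ⟨N, K, hKfin, ⟨Homeomorph.ulift⟩⟩ }
  refine ⟨P, ⟨fun x => ULift.up ⟨WithLp.toLp 2 fun k => w k x, hwK x⟩, ?_⟩,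
    ⟨fun p : ULift.{u} K.space => π p.down, ?_⟩, fun p => hKW _ p.down.2, fun x => rfl⟩
  · exact continuous_uliftUp.comp (Continuous.subtype_mk ((PiLp.continuous_toLp 2 _).comp
      (continuous_pi fun k => (w k).continuous)) _)
  · exact π.continuous_of_finiteDimensional.comp
      (continuous_subtype_val.comp continuous_uliftDown)

/-- A continuous map from a compact space to an open subset of a finite dimensional space factors
through a compact polyhedron. -/
theorem exists_polyhedron_factorization {X : Type u} [TopologicalSpace X] [CompactSpace X]
    [T2Space X] {F : Type*} [NormedAddCommGroup F] [NormedSpace ℝ F] [FiniteDimensional ℝ F]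
    (f : C(X, F)) {W : Set F} (hW : IsOpen W) (hf : ∀ x, f x ∈ W) :
    ∃ (P : CompHausLike.{u} IsCompactPolyhedron) (a : C(X, P)) (b : C(P, F)),
      (∀ p, b p ∈ W) ∧ ∀ x, b (a x) = f x := by
  classical
  obtain ⟨δ, hδ, hδW⟩ := (isCompact_range f.continuous).exists_thickening_subset_open hW
    (range_subset_iff.2 hf)
  -- Barycentric coordinates in small simplices around the values reproduce f exactly, also after
  -- averaging by a partition of unity. With radius δ / 2, all vertices used at x are within δ of f
  -- x.
  choose B hB hBball using fun y : F =>
    exists_mem_interior_convexHull_affineBasis (Metric.ball_mem_nhds y (half_pos hδ))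
  obtain ⟨t, ht⟩ := CompactSpace.elim_nhds_subcover
    (fun x => f ⁻¹' interior (convexHull ℝ (range (B (f x)))))
    (fun x => (isOpen_interior.preimage f.continuous).mem_nhds (hB (f x)))
  obtain ⟨μ, hμ⟩ := PartitionOfUnity.exists_isSubordinate (s := univ) isClosed_univ
    (fun y : t => f ⁻¹' interior (convexHull ℝ (range (B (f y)))))
    (fun y => isOpen_interior.preimage f.continuous)
    (fun x _ => by
      obtain ⟨y, hy, hxy⟩ := mem_iUnion₂.1 (ht.ge (mem_univ x))
      exact mem_iUnion.2 ⟨⟨y, hy⟩, hxy⟩)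
  have hμ0 : ∀ y x, μ y x ≠ 0 → f x ∈ interior (convexHull ℝ (range (B (f (y : X))))) :=
    fun y x h => hμ y (subset_tsupport _ h)
  have hcoord : ∀ (y : t) x i, μ y x ≠ 0 → 0 ≤ (B (f y)).coord i (f x) := by
    intro y x i h
    have := hμ0 y x h
    rw [AffineBasis.interior_convexHull] at this
    exact (this i).le
  have hμ1 : ∀ x, ∑ y, μ y x = 1 := fun x => by
    rw [← finsum_eq_sum_of_fintype]
    exact μ.sum_eq_one (mem_univ x)
  let κ := t × Fin (Module.finrank ℝ F + 1)
  let v : κ → F := fun k => B (f k.1) k.2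
  let w : κ → C(X, ℝ) := fun k =>
    ⟨fun x => μ k.1 x * (B (f k.1)).coord k.2 (f x), (μ k.1).continuous.mul
      ((continuous_barycentric_coord _ _).comp f.continuous)⟩
  have hsum : ∀ x, ∑ k, w k x = 1 := by
    intro x
    rw [Fintype.sum_prod_type, ← hμ1 x]
    refine Finset.sum_congr rfl fun y _ => ?_
    simp only [w, ContinuousMap.coe_mk]
    rw [← Finset.mul_sum, AffineBasis.sum_coord_apply_eq_one, mul_one]
  have hcomb : ∀ x, ∑ k, w k x • v k = f x := by
    intro x
    rw [Fintype.sum_prod_type]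
    simp only [w, v, ContinuousMap.coe_mk, mul_smul]
    simp_rw [← Finset.smul_sum, AffineBasis.linear_combination_coord_eq_self]
    rw [← Finset.sum_smul, hμ1, one_smul]
  let ε := (Fintype.equivFin κ).symm
  obtain ⟨P, a, b, hb, hab⟩ := exists_polyhedron_of_barycentric (v ∘ ε) (w ∘ ε) W
    (fun k x => by
      by_cases h : μ (ε k).1 x = 0
      · simp [w, h]
      · exact mul_nonneg (μ.nonneg _ _) (hcoord _ x _ h))
    (fun x => (Equiv.sum_comp ε fun k => w k x).trans (hsum x))
    (fun x => by
      refine Subset.trans (convexHull_min ?_ (convex_ball (f x) δ)) (Subset.trans ?_ hδW)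
      · rintro _ ⟨k, hk, rfl⟩
        have hne : μ (ε k).1 x ≠ 0 := fun h => by simp [w, h] at hk
        have h1 := hBball _ (interior_subset (hμ0 _ x hne))
        have h2 := hBball _ (subset_convexHull ℝ _ (mem_range_self (f := B (f (ε k).1)) (ε k).2))
        rw [Metric.mem_ball] at h1 h2 ⊢
        rw [dist_comm] at h1
        exact (dist_triangle _ _ _).trans_lt (by simp only [v, Function.comp_apply]; linarith)
      · exact Metric.ball_subset_thickening (mem_range_self x) δ)
  refine ⟨P, a, b, hb, fun x => (hab x).trans ?_⟩
  exact (Equiv.sum_comp ε fun k => w k x • v k).trans (hcomb x)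

/-! ### Homotopy invariance of natural classes -/

/-- The functionPullback of functions along a continuous map, as a morphism of commutative algebras. -/
noncomputable def functionPullback {T T' : Type u} [TopologicalSpace T] [TopologicalSpace T']
    (a : C(T', T)) : CommAlgCat.of ℂ C(T, ℂ) ⟶ CommAlgCat.of ℂ C(T', ℂ) :=
  CommAlgCat.ofHom (ContinuousMap.compRightAlgHom ℂ ℂ a)

section

variable (G : CommAlgCat.{u} ℂ ⥤ AddCommGrpCat.{u})
  (hG : IsHomotopyInvariant (continuousFunctions.{u} IsCompactPolyhedron ⋙ G))
  {F : Type} [NormedAddCommGroup F] [NormedSpace ℝ F] [FiniteDimensional ℝ F]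
  {K U : Set F} (hU : IsOpen U) {r : F → F} (hr : ContinuousOn r U) (hrK : MapsTo r U K)
  (hrid : ∀ y ∈ K, r y = y)
  (Ψ : ∀ (T : Type u) [TopologicalSpace T] (w : C(T, F)), (∀ t, w t ∈ K) →
    G.obj (CommAlgCat.of ℂ C(T, ℂ)))
  (hΨ : ∀ (T T' : Type u) [TopologicalSpace T] [TopologicalSpace T'] (a : C(T', T))
    (w : C(T, F)) (hw : ∀ t, w t ∈ K),
    Ψ T' (w.comp a) (fun t => hw (a t)) = G.map (functionPullback a) (Ψ T w hw))

include hG hU hr hrK hrid hΨ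

/-- A natural class attached to the maps to a neighbourhood retract takes the same value on maps
that are close to each other. -/
theorem class_eq_of_close {δ : ℝ} (hδ : Metric.thickening δ K ⊆ U) {X : Type u}
    [TopologicalSpace X] [CompactSpace X] [T2Space X] (u₀ u₁ : C(X, F)) (h₀ : ∀ x, u₀ x ∈ K)
    (h₁ : ∀ x, u₁ x ∈ K) (hclose : ∀ x, dist (u₁ x) (u₀ x) < δ) : Ψ X u₀ h₀ = Ψ X u₁ h₁ := by
  -- A pair in this set lies in a common ball inside U, so its segment stays in U even for points of
  -- P outside the image of X.
  have hWo : IsOpen (⋃ k ∈ K, Metric.ball k δ ×ˢ Metric.ball k δ) :=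
    isOpen_biUnion fun k _ => Metric.isOpen_ball.prod Metric.isOpen_ball
  obtain ⟨P, a, b, hb, hab⟩ := exists_polyhedron_factorization (u₀.prodMk u₁) hWo fun x =>
    mem_iUnion₂.2 ⟨u₀ x, h₀ x, by
      have := dist_nonneg.trans_lt (hclose x)
      exact ⟨Metric.mem_ball_self this, hclose x⟩⟩
  let h : C(unitInterval × P, F) :=
    ⟨fun z => AffineMap.lineMap (b z.2).1 (b z.2).2 (z.1 : ℝ), by
      simp only [AffineMap.lineMap_apply_module]
      fun_prop⟩
  have hU' : ∀ z, h z ∈ U := by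
    intro z
    obtain ⟨k, hk, hk1, hk2⟩ := mem_iUnion₂.1 (hb z.2)
    exact hδ (Metric.ball_subset_thickening hk δ
      ((convex_ball k δ).lineMap_mem hk1 hk2 z.1.2))
  let h' : C(ULift.{u} unitInterval × P, F) :=
    h.comp ⟨fun z => (z.1.down, z.2), by fun_prop⟩
  -- Factoring through Q avoids triangulating the cylinder over P.
  obtain ⟨Q, a', b', hb', hab'⟩ := exists_polyhedron_factorization h' hU fun z => hU' _
  let w : C(Q, F) := ⟨fun q => r (b' q), hr.comp_continuous b'.continuous hb'⟩
  have hw : ∀ q, w q ∈ K := fun q => hrK (hb' q)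
  let i : unitInterval → C(P, Q) := fun t =>
    a'.comp ⟨fun p => (ULift.up t, p), by fun_prop⟩
  have hhom : ContinuousMap.Homotopic (i 0) (i 1) :=
    ⟨{ toFun := fun z => a' (ULift.up z.1, z.2)
       continuous_toFun := a'.continuous.comp
        ((continuous_uliftUp.comp continuous_fst).prodMk continuous_snd)
       map_zero_left := fun _ => rfl
       map_one_left := fun _ => rfl }⟩
  have hmaps : G.map (functionPullback (i 0)) = G.map (functionPullback (i 1)) :=
    hG (X := P) (Y := Q) (ConcreteCategory.ofHom (C := CompHausLike IsCompactPolyhedron) (i 0))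
      (ConcreteCategory.ofHom (C := CompHausLike IsCompactPolyhedron) (i 1)) hhom
  -- On P the ends of the homotopy may leave K, but after composition with a they are the given maps
  -- to K, which r fixes.
  have hfac : ∀ (u' : C(X, F)) (hu' : ∀ x, u' x ∈ K) (t : unitInterval),
      (∀ x, h (t, a x) = u' x) →
      Ψ X u' hu' = G.map (functionPullback a) (G.map (functionPullback (i t)) (Ψ Q w hw)) := by
    intro u' hu' t ht
    rw [← hΨ, ← hΨ]
    have he : u' = (w.comp (i t)).comp a := by
      ext x
      have h1 : b' (a' (ULift.up t, a x)) = u' x := (hab' _).trans (ht x)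
      change u' x = r (b' (a' (ULift.up t, a x)))
      rw [h1, hrid _ (hu' x)]
    subst he
    rfl
  rw [hfac u₀ h₀ 0 (fun x => by simp [h, hab]), hfac u₁ h₁ 1 (fun x => by simp [h, hab]), hmaps]

/-- A natural class attached to the maps to a compact neighbourhood retract is homotopy
invariant. -/
theorem class_eq_of_homotopy (hK : IsCompact K) (hKU : K ⊆ U) {X : Type u}
    [TopologicalSpace X] [CompactSpace X] [T2Space X] (H : C(unitInterval × X, F))
    (hH : ∀ z, H z ∈ K) :
    Ψ X (H.curry 0) (fun _ => hH _) = Ψ X (H.curry 1) (fun _ => hH _) := by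
  obtain ⟨δ, hδ, hδU⟩ := hK.exists_thickening_subset_open hU hKU
  have hloc : IsLocallyConstant fun t => Ψ X (H.curry t) (fun _ => hH _) := by
    rw [IsLocallyConstant.iff_eventually_eq]
    intro t
    filter_upwards [H.curry.continuous.continuousAt.eventually
      (Metric.ball_mem_nhds (H.curry t) hδ)] with s hs
    refine (class_eq_of_close G hG hU hr hrK hrid Ψ hΨ hδU _ _ _ _ fun x => ?_).symm
    exact (ContinuousMap.dist_apply_le_dist x).trans_lt hs
  exact hloc.apply_eq_of_preconnectedSpace 0 1

end

/-! ### Reduction to finitely generated subalgebras -/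

section FinitelyGenerated

variable (R : CommAlgCat.{u} ℂ)

/-- The directed system of finitely generated subalgebras of a commutative algebra. -/
noncomputable def adjoinFunctor : Finset R ⥤ CommAlgCat.{u} ℂ where
  obj S := CommAlgCat.of ℂ (Algebra.adjoin ℂ (S : Set R))
  map f := CommAlgCat.ofHom (Subalgebra.inclusion (Algebra.adjoin_mono (leOfHom f)))
  map_id _ := rfl
  map_comp _ _ := rfl

/-- The inclusion of a finitely generated subalgebra. -/
noncomputable def adjoinInclusion (S : Finset R) : (adjoinFunctor R).obj S ⟶ R :=
  CommAlgCat.ofHom (Algebra.adjoin ℂ (S : Set R)).val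

/-- An algebra is a cocone over its finitely generated subalgebras. -/
noncomputable def adjoinCocone : Cocone (adjoinFunctor R) where
  pt := R
  ι := { app := adjoinInclusion R, naturality := fun _ _ _ => rfl }

variable {R}

theorem mem_adjoin_self {x : R} {S : Finset R} (h : x ∈ S) : x ∈ Algebra.adjoin ℂ (S : Set R) :=
  Algebra.subset_adjoin h

/-- A compatible family of functions on the finitely generated subalgebras is induced by a
function on the algebra. -/
theorem exists_function_of_compatible {B : Type*}
    (g : ∀ S : Finset R, Algebra.adjoin ℂ (S : Set R) → B)
    (hg : ∀ (S T : Finset R) (h : S ≤ T) x,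
      g T (Subalgebra.inclusion (Algebra.adjoin_mono h) x) = g S x) :
    ∃ f : R → B, ∀ (S : Finset R) (x : Algebra.adjoin ℂ (S : Set R)), f x = g S x := by
  classical
  refine ⟨fun x => g {x} ⟨x, mem_adjoin_self (by simp)⟩, fun S x => ?_⟩
  exact (hg {(x : R)} (S ∪ {(x : R)}) Finset.subset_union_right ⟨x, _⟩).symm.trans
    (hg S (S ∪ {(x : R)}) Finset.subset_union_left x)

variable (R) in
/-- A commutative algebra is the colimit of its finitely generated subalgebras. -/
theorem nonempty_isColimit_adjoinCocone : Nonempty (IsColimit (adjoinCocone R)) := by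
  classical
  have key : ∀ s : Cocone (adjoinFunctor R), ∃ f : R ⟶ s.pt,
      ∀ S, adjoinInclusion R S ≫ f = s.ι.app S := by
    intro s
    obtain ⟨f, hf⟩ := exists_function_of_compatible (R := R) (B := s.pt)
      (fun S x => (s.ι.app S).hom x) (fun S T h x =>
        congrArg (fun φ : (adjoinFunctor R).obj S ⟶ s.pt => φ.hom x) (s.w (homOfLE h)))
    have hpair : ∀ x y : R, ∃ (S : Finset R) (x' y' : Algebra.adjoin ℂ (S : Set R)),
        (x' : R) = x ∧ (y' : R) = y := fun x y =>
      ⟨{x, y}, ⟨x, mem_adjoin_self (by simp)⟩, ⟨y, mem_adjoin_self (by simp)⟩, rfl, rfl⟩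
    refine ⟨CommAlgCat.ofHom
      { toFun := f
        map_one' := (hf ∅ 1).trans (map_one _)
        map_mul' := fun x y => ?_
        map_zero' := (hf ∅ 0).trans (map_zero _)
        map_add' := fun x y => ?_
        commutes' := fun c => (hf ∅ (algebraMap ℂ _ c)).trans (AlgHom.commutes _ c) },
      fun S => ?_⟩
    · obtain ⟨S, x, y, rfl, rfl⟩ := hpair x y
      rw [hf, hf]
      exact (hf S (x * y)).trans (map_mul _ _ _)
    · obtain ⟨S, x, y, rfl, rfl⟩ := hpair x y
      rw [hf, hf]
      exact (hf S (x + y)).trans (map_add _ _ _)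
    · apply CommAlgCat.hom_ext
      ext x
      exact hf S x
  choose f hf using key
  exact ⟨{ desc := f
           fac := hf
           uniq := fun s m hm => by
            apply CommAlgCat.hom_ext
            ext x
            have h1 := (hm {x}).trans (hf s {x}).symm
            exact congrArg (fun φ : (adjoinFunctor R).obj {x} ⟶ s.pt =>
              φ.hom ⟨x, mem_adjoin_self (Finset.mem_singleton_self x)⟩) h1 }⟩

variable (R) in
/-- A commutative algebra is the colimit of its finitely generated unital subalgebras in the
category of not necessarily unital algebras. -/
theorem nonempty_isColimit_forgetUnit_adjoinCocone :
    Nonempty (IsColimit (forgetUnit.mapCocone (adjoinCocone R))) := by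
  classical
  have key : ∀ s : Cocone (adjoinFunctor R ⋙ forgetUnit), ∃ f : forgetUnit.obj R ⟶ s.pt,
      ∀ S, forgetUnit.map (adjoinInclusion R S) ≫ f = s.ι.app S := by
    intro s
    let φ : ∀ S : Finset R, Algebra.adjoin ℂ (S : Set R) →ₙₐ[ℂ] s.pt.carrier := fun S => s.ι.app S
    obtain ⟨f, hf⟩ := exists_function_of_compatible (R := R)
      (fun S x => φ S x) (fun S T h x =>
        congrArg (fun ψ : Algebra.adjoin ℂ (S : Set R) →ₙₐ[ℂ] s.pt.carrier => ψ x)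
          (s.w (homOfLE h)))
    have hpair : ∀ x y : R, ∃ (S : Finset R) (x' y' : Algebra.adjoin ℂ (S : Set R)),
        (x' : R) = x ∧ (y' : R) = y := fun x y =>
      ⟨{x, y}, ⟨x, mem_adjoin_self (by simp)⟩, ⟨y, mem_adjoin_self (by simp)⟩, rfl, rfl⟩
    let f' : R →ₙₐ[ℂ] s.pt.carrier :=
      { toFun := f
        map_smul' := fun c x => by
          obtain ⟨S, x, -, rfl, -⟩ := hpair x x
          rw [hf]
          exact (hf S (c • x)).trans (map_smul (φ S) c x)
        map_zero' := (hf ∅ 0).trans (map_zero _)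
        map_add' := fun x y => by
          obtain ⟨S, x, y, rfl, rfl⟩ := hpair x y
          rw [hf, hf]
          exact (hf S (x + y)).trans (map_add _ _ _)
        map_mul' := fun x y => by
          obtain ⟨S, x, y, rfl, rfl⟩ := hpair x y
          rw [hf, hf]
          exact (hf S (x * y)).trans (map_mul _ _ _) }
    refine ⟨f', fun S => ?_⟩
    exact NonUnitalAlgHom.ext (f := f'.comp (NonUnitalAlgHomClass.toNonUnitalAlgHom
      (Algebra.adjoin ℂ (S : Set R)).val)) (g := φ S) fun x => hf S x
  choose f hf using key
  exact ⟨{ desc := f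
           fac := hf
           uniq := fun s m hm => by
            refine NonUnitalAlgHom.ext (A := R) (B := s.pt.carrier) fun x => ?_
            have h1 := (hm {x}).trans (hf s {x}).symm
            exact congrArg (fun φ : Algebra.adjoin ℂ (({x} : Finset R) : Set R) →ₙₐ[ℂ]
              s.pt.carrier => φ ⟨x, mem_adjoin_self (Finset.mem_singleton_self x)⟩) h1 }⟩

/-- A functor on commutative algebras is supported on the finitely generated subalgebras if all its
elements come from finitely generated subalgebras. -/
def IsFinitelySupported (G : CommAlgCat.{u} ℂ ⥤ AddCommGrpCat.{u}) : Prop :=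
  ∀ (R : CommAlgCat.{u} ℂ) (ξ : G.obj R), ∃ (S : Finset R) (η : G.obj ((adjoinFunctor R).obj S)),
    G.map (adjoinInclusion R S) η = ξ

theorem isFinitelySupported_of_preservesFilteredColimits (E : CommAlgCat.{u} ℂ ⥤ AddCommGrpCat.{u})
    (hE : PreservesFilteredColimits E) : IsFinitelySupported E := by
  classical
  intro R ξ
  obtain ⟨hc⟩ := nonempty_isColimit_adjoinCocone R
  have := hE.preserves_filtered_colimits (Finset R)
  exact Concrete.isColimit_exists_rep _ (isColimitOfPreserves E hc) ξ

/-- The unital subalgebras still have the algebra as colimit once units are forgotten, so the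
nonunital case reduces to functors on unital algebras. -/
theorem isFinitelySupported_forgetUnit_comp (E : NonUnitalCommAlgCat.{u} ⥤ AddCommGrpCat.{u})
    (hE : PreservesFilteredColimits E) : IsFinitelySupported (forgetUnit ⋙ E) := by
  classical
  intro R ξ
  obtain ⟨hc⟩ := nonempty_isColimit_forgetUnit_adjoinCocone R
  have := hE.preserves_filtered_colimits (Finset R)
  exact Concrete.isColimit_exists_rep _ (isColimitOfPreserves E hc) ξ

end FinitelyGenerated

/-! ### Bounded parts of complex affine varieties -/

section ComplexVariety

variable {σ : Type*} {N : ℕ} (ε : σ ⊕ σ ≃ Fin N)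

/-- The complex point with given real and imaginary coordinates. -/
noncomputable def complexPoint (y : Fin N → ℝ) (s : σ) : ℂ :=
  y (ε (Sum.inl s)) + y (ε (Sum.inr s)) * Complex.I

theorem continuous_complexPoint : Continuous (complexPoint ε) := by
  unfold complexPoint
  fun_prop

theorem isPolyIntegral_re_im (p : MvPolynomial σ ℂ) :
    IsPolyIntegral (fun y => (MvPolynomial.aeval (complexPoint ε y) p).re) ∧
      IsPolyIntegral (fun y => (MvPolynomial.aeval (complexPoint ε y) p).im) := by
  induction p using MvPolynomial.induction_on with
  | C c =>
    simp only [MvPolynomial.aeval_C, Algebra.algebraMap_self, RingHom.id_apply]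
    exact ⟨IsPolyIntegral.const _, IsPolyIntegral.const _⟩
  | add p q hp hq =>
    simp only [map_add, Complex.add_re, Complex.add_im]
    exact ⟨hp.1.add hq.1, hp.2.add hq.2⟩
  | mul_X p s hp =>
    simp only [map_mul, MvPolynomial.aeval_X, Complex.mul_re, Complex.mul_im]
    have h1 : IsPolyIntegral fun y => (complexPoint ε y s).re := by
      simpa [complexPoint] using IsPolyIntegral.coord (ε (Sum.inl s))
    have h2 : IsPolyIntegral fun y => (complexPoint ε y s).im := by
      simpa [complexPoint] using IsPolyIntegral.coord (ε (Sum.inr s))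
    exact ⟨(hp.1.mul h1).sub (hp.2.mul h2), (hp.1.mul h2).add (hp.2.mul h1)⟩

/-- The points of a complex affine variety in a ball. -/
def boundedVariety (I : Ideal (MvPolynomial σ ℂ)) (ρ : ℝ) : Set (Fin N → ℝ) :=
  {y | (∀ p ∈ I, MvPolynomial.aeval (complexPoint ε y) p = 0) ∧ ∑ k, y k ^ 2 ≤ ρ}

/-- The part of a complex affine variety in a ball is a compact neighbourhood retract. -/
theorem boundedVariety_retract [Finite σ] (I : Ideal (MvPolynomial σ ℂ)) (ρ : ℝ) :
    IsCompact (boundedVariety ε I ρ) ∧ ∃ (U : Set (Fin N → ℝ)) (r : (Fin N → ℝ) → (Fin N → ℝ)),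
      IsOpen U ∧ boundedVariety ε I ρ ⊆ U ∧ ContinuousOn r U ∧ MapsTo r U (boundedVariety ε I ρ) ∧
      ∀ y ∈ boundedVariety ε I ρ, r y = y := by
  obtain ⟨T, hT⟩ := (isNoetherianRing_iff_ideal_fg (MvPolynomial σ ℂ)).1 inferInstance I
  -- A sum of squares over finitely many generators of I, with a maximum encoding the ball; this is
  -- integral though not polynomial.
  let h : (Fin N → ℝ) → ℝ := fun y =>
    ∑ p ∈ T, ((MvPolynomial.aeval (complexPoint ε y) p).re ^ 2 +
      (MvPolynomial.aeval (complexPoint ε y) p).im ^ 2) + max (∑ k, y k ^ 2 - ρ) 0 ^ 2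
  have hI : IsPolyIntegral h :=
    (IsPolyIntegral.sum T fun p _ => ((isPolyIntegral_re_im ε p).1.pow 2).add
      ((isPolyIntegral_re_im ε p).2.pow 2)).add
    ((((IsPolyIntegral.sum Finset.univ fun k _ => (IsPolyIntegral.coord k).pow 2).sub
      (IsPolyIntegral.const ρ)).max (IsPolyIntegral.const 0)).pow 2)
  have hzero : ∀ z : ℂ, z.re ^ 2 + z.im ^ 2 = 0 ↔ z = 0 := fun z => by
    rw [add_sq_eq_zero_iff (sq_nonneg _), pow_eq_zero_iff two_ne_zero, Complex.ext_iff]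
    rfl
  have hV : boundedVariety ε I ρ = {y | h y = 0} := by
    ext y
    have hnn : ∀ p ∈ T, 0 ≤ (MvPolynomial.aeval (complexPoint ε y) p).re ^ 2 +
        (MvPolynomial.aeval (complexPoint ε y) p).im ^ 2 := fun p _ => by positivity
    simp only [boundedVariety, mem_ofPred_eq, h]
    rw [add_sq_eq_zero_iff (Finset.sum_nonneg hnn), max_eq_right_iff, sub_nonpos,
      Finset.sum_eq_zero_iff_of_nonneg hnn]
    refine and_congr_left fun _ => ?_
    simp only [hzero]
    have : I ≤ RingHom.ker (MvPolynomial.aeval (R := ℂ) (complexPoint ε y)) ↔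
        ∀ p ∈ T, MvPolynomial.aeval (complexPoint ε y) p = 0 := by
      rw [← hT, Ideal.span_le]
      rfl
    exact this
  have hc : IsCompact {y | h y = 0} := by
    refine Metric.isCompact_of_isClosed_isBounded (isClosed_eq hI.1 continuous_const)
      (isBounded_iff_forall_norm_le.2 ⟨max ρ 0 + 1, fun y hy => ?_⟩)
    rw [← hV] at hy
    refine (pi_norm_le_iff_of_nonneg (by positivity)).2 fun k => ?_
    have h1 : y k ^ 2 ≤ max ρ 0 :=
      (Finset.single_le_sum (f := fun k => y k ^ 2) (fun k _ => sq_nonneg _)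
        (Finset.mem_univ k)).trans (hy.2.trans (le_max_left _ _))
    rw [Real.norm_eq_abs]
    have := le_max_right ρ 0
    exact abs_le_of_sq_le_sq (by nlinarith) (by positivity)
  rw [hV]
  -- Extending the identity of the zero set to a neighbourhood in ℝᴺ gives the retraction.
  obtain ⟨U, r, hU, hKU, hr, hrm, hrid⟩ := hI.isANE_zeros hc (Fin N → ℝ) {y | h y = 0} id
    hc.isClosed continuousOn_id (mapsTo_id _)
  exact ⟨hc, U, r, hU, hKU, hr, hrm, fun y hy => hrid hy⟩

end ComplexVariety

/-! ### Assembling the theorem -/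

/-- A functor supported on the finitely generated subalgebras is homotopy invariant on compact
Hausdorff spaces if it is so on compact polyhedra. -/
theorem IsFinitelySupported.isHomotopyInvariant {G : CommAlgCat.{u} ℂ ⥤ AddCommGrpCat.{u}}
    (hfin : IsFinitelySupported G)
    (hG : IsHomotopyInvariant (continuousFunctions.{u} IsCompactPolyhedron ⋙ G)) :
    IsHomotopyInvariant (continuousFunctions.{u} (fun _ => True) ⋙ G) := by
  classical
  rintro X Y f g ⟨H⟩
  ext ξ
  obtain ⟨S, η, rfl⟩ := hfin (CommAlgCat.of ℂ C(Y, ℂ)) ξ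
  let σ := {s : C(Y, ℂ) // s ∈ S}
  let ε : σ ⊕ σ ≃ Fin (Fintype.card (σ ⊕ σ)) := Fintype.equivFin _
  let A := Algebra.adjoin ℂ (S : Set C(Y, ℂ))
  let π : MvPolynomial σ ℂ →ₐ[ℂ] A :=
    MvPolynomial.aeval fun s => ⟨s.1, Algebra.subset_adjoin s.2⟩
  have hπ : Function.Surjective π := by
    rintro ⟨a, ha⟩
    have ha' : a ∈ Algebra.adjoin ℂ (S : Set C(Y, ℂ)) := ha
    rw [Algebra.adjoin_eq_range] at ha'
    obtain ⟨p, rfl⟩ := ha'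
    refine ⟨p, Subtype.ext ?_⟩
    change A.val (π p) = _
    rw [← AlgHom.comp_apply, MvPolynomial.comp_aeval]
    rfl
  let I : Ideal (MvPolynomial σ ℂ) := RingHom.ker π
  -- the coordinates of a point of `Y`
  let e : C(Y, Fin (Fintype.card (σ ⊕ σ)) → ℝ) :=
    ⟨fun y k => Sum.elim (fun s : σ => (s.1 y).re) (fun s : σ => (s.1 y).im) (ε.symm k), by
      refine continuous_pi fun k => ?_
      rcases ε.symm k with s | s
      · exact Complex.continuous_re.comp s.1.continuous
      · exact Complex.continuous_im.comp s.1.continuous⟩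
  have heval : ∀ y p, MvPolynomial.aeval (complexPoint ε (e y)) p = (π p : C(Y, ℂ)) y := by
    intro y p
    have h1 : complexPoint ε (e y) = fun s : σ => s.1 y := by
      funext s
      simp [complexPoint, e]
    let ev : A →ₐ[ℂ] ℂ := (ContinuousMap.evalAlgHom ℂ ℂ y).comp A.val
    have h2 : ev.comp π = MvPolynomial.aeval (complexPoint ε (e y)) := by
      rw [h1, MvPolynomial.comp_aeval]
      rfl
    exact (DFunLike.congr_fun h2 p).symm
  obtain ⟨ρ, hρ⟩ : ∃ ρ, ∀ y, ∑ k, e y k ^ 2 ≤ ρ := by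
    have hc : Continuous fun y => ∑ k, e y k ^ 2 := by fun_prop
    obtain ⟨ρ, hρ⟩ := (isCompact_range hc).bddAbove
    exact ⟨ρ, fun y => hρ ⟨y, rfl⟩⟩
  have heK : ∀ y, e y ∈ boundedVariety ε I ρ := fun y => ⟨fun p hp => by
    rw [heval, RingHom.mem_ker.1 hp]; rfl, hρ y⟩
  obtain ⟨hK, U, r, hU, hKU, hr, hrK, hrid⟩ := boundedVariety_retract ε I ρ
  -- maps to the variety induce homomorphisms on the finitely generated algebra
  let θ₀ : ∀ (T : Type u) [TopologicalSpace T] (w : C(T, Fin (Fintype.card (σ ⊕ σ)) → ℝ)),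
      MvPolynomial σ ℂ →ₐ[ℂ] C(T, ℂ) := fun T _ w => MvPolynomial.aeval fun s =>
    ⟨fun t => complexPoint ε (w t) s,
      (continuous_apply s).comp ((continuous_complexPoint ε).comp w.continuous)⟩
  have hθ₀ : ∀ (T : Type u) [TopologicalSpace T] (w : C(T, Fin (Fintype.card (σ ⊕ σ)) → ℝ)) p t,
      θ₀ T w p t = MvPolynomial.aeval (complexPoint ε (w t)) p := by
    intro T _ w p t
    have : (ContinuousMap.evalAlgHom ℂ ℂ t).comp (θ₀ T w) =
        MvPolynomial.aeval (complexPoint ε (w t)) := by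
      rw [MvPolynomial.comp_aeval]
      rfl
    exact DFunLike.congr_fun this p
  -- Polynomials in I vanish at all points of the variety, so evaluation along w descends to A.
  have hker : ∀ (T : Type u) [TopologicalSpace T] (w : C(T, Fin (Fintype.card (σ ⊕ σ)) → ℝ)),
      (∀ t, w t ∈ boundedVariety ε I ρ) → RingHom.ker π ≤ RingHom.ker (θ₀ T w) := by
    intro T _ w hw p hp
    rw [RingHom.mem_ker]
    ext t
    rw [hθ₀]
    exact (hw t).1 p hp
  let θ : ∀ (T : Type u) [TopologicalSpace T] (w : C(T, Fin (Fintype.card (σ ⊕ σ)) → ℝ)),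
      (∀ t, w t ∈ boundedVariety ε I ρ) → (A →ₐ[ℂ] C(T, ℂ)) := fun T _ w hw =>
    AlgHom.liftOfSurjective π hπ (θ₀ T w) (hker T w hw)
  have hθ : ∀ (T : Type u) [TopologicalSpace T] (w : C(T, Fin (Fintype.card (σ ⊕ σ)) → ℝ))
      (hw : ∀ t, w t ∈ boundedVariety ε I ρ) p t,
      θ T w hw (π p) t = MvPolynomial.aeval (complexPoint ε (w t)) p := by
    intro T _ w hw p t
    rw [← hθ₀]
    exact congrArg (fun c : C(T, ℂ) => c t) (AlgHom.liftOfSurjective_apply _ _ _ _ p)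
  let Ψ : ∀ (T : Type u) [TopologicalSpace T] (w : C(T, Fin (Fintype.card (σ ⊕ σ)) → ℝ)),
      (∀ t, w t ∈ boundedVariety ε I ρ) → G.obj (CommAlgCat.of ℂ C(T, ℂ)) := fun T _ w hw =>
    G.map (CommAlgCat.ofHom (θ T w hw)) η
  have hΨ : ∀ (T T' : Type u) [TopologicalSpace T] [TopologicalSpace T'] (a : C(T', T))
      (w : C(T, Fin (Fintype.card (σ ⊕ σ)) → ℝ)) (hw : ∀ t, w t ∈ boundedVariety ε I ρ),
      Ψ T' (w.comp a) (fun t => hw (a t)) = G.map (functionPullback a) (Ψ T w hw) := by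
    intro T T' _ _ a w hw
    have h1 : CommAlgCat.ofHom (θ T' (w.comp a) fun t => hw (a t)) =
        CommAlgCat.ofHom (θ T w hw) ≫ functionPullback a := by
      apply CommAlgCat.hom_ext
      refine AlgHom.ext fun x => ?_
      obtain ⟨p, rfl⟩ := hπ x
      ext t
      exact (hθ T' (w.comp a) (fun t => hw (a t)) p t).trans (hθ T w hw p (a t)).symm
    change G.map (CommAlgCat.ofHom (θ T' (w.comp a) fun t => hw (a t))) η = _
    rw [h1, G.map_comp]
    rfl
  -- Evaluation along e ∘ v is the inclusion of A in C(Y) followed by pullback along v, so Ψ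
  -- computes the induced maps on the given class.
  have hΨe : ∀ v : C(X, Y), Ψ X (e.comp v) (fun _ => heK _) =
      G.map (functionPullback v) (G.map (adjoinInclusion (CommAlgCat.of ℂ C(Y, ℂ)) S) η) := by
    intro v
    have h1 : CommAlgCat.ofHom (θ X (e.comp v) fun _ => heK _) =
        adjoinInclusion (CommAlgCat.of ℂ C(Y, ℂ)) S ≫ functionPullback v := by
      apply CommAlgCat.hom_ext
      refine AlgHom.ext fun x => ?_
      obtain ⟨p, rfl⟩ := hπ x
      ext t
      exact (hθ X (e.comp v) (fun _ => heK _) p t).trans (heval (v t) p)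
    exact (congrArg (fun φ => G.map φ η) h1).trans
      (ConcreteCategory.congr_hom (G.map_comp (adjoinInclusion (CommAlgCat.of ℂ C(Y, ℂ)) S)
        (functionPullback v)) η)
  have key := class_eq_of_homotopy G hG hU hr hrK hrid Ψ hΨ hK hKU
    (e.comp H.toContinuousMap) fun z => heK _
  let f' : C(X, Y) := ConcreteCategory.hom (C := CompHausLike fun _ => True) f
  let g' : C(X, Y) := ConcreteCategory.hom (C := CompHausLike fun _ => True) g
  have h0 : (e.comp H.toContinuousMap).curry 0 = e.comp f' := by
    ext x : 1
    exact congrArg e (H.apply_zero x)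
  have h1 : (e.comp H.toContinuousMap).curry 1 = e.comp g' := by
    ext x : 1
    exact congrArg e (H.apply_one x)
  simp only [h0, h1] at key
  exact (hΨe f').symm.trans (key.trans (hΨe g'))

/-- The criterion, both for functors on unital commutative `ℂ`-algebras (with unital
homomorphisms) and for functors on not necessarily unital commutative `ℂ`-algebras. -/
theorem theorem6p2 :
    (∀ E : CommAlgCat.{u} ℂ ⥤ AddCommGrpCat.{u},
      PreservesFilteredColimits E →
      IsHomotopyInvariant (continuousFunctions.{u} IsCompactPolyhedron ⋙ E) →
      IsHomotopyInvariant (continuousFunctions.{u} (fun _ => True) ⋙ E)) ∧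
    (∀ E : NonUnitalCommAlgCat.{u} ⥤ AddCommGrpCat.{u},
      PreservesFilteredColimits E →
      IsHomotopyInvariant (continuousFunctions.{u} IsCompactPolyhedron ⋙ forgetUnit ⋙ E) →
      IsHomotopyInvariant (continuousFunctions.{u} (fun _ => True) ⋙ forgetUnit ⋙ E)) :=
  ⟨fun E hE => (isFinitelySupported_of_preservesFilteredColimits E hE).isHomotopyInvariant,
    fun E hE => (isFinitelySupported_forgetUnit_comp E hE).isHomotopyInvariant⟩
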